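/- **Model.** Alice and Bob each pull one of two arms, $L$ or $R$, in every round $t=0,1,2,\dots$. All rewards lie in $\{0,1\}$. Arm $L$ has a known success probability $p\in[0,1]$. The success probability $\theta$ of arm $R$ is drawn once, before the game starts, from a prior $\mu$ on $[0,1]$ that is not a point mass and has mean $m$; given $\theta$, the rewards of arm $R$ are i.i.d. Bernoulli($\theta$). (If both players pull the same arm in the same round, their rewards are either two independent draws or one common draw; the result below holds under either convention.) After each round, each player observes their own reward and the arm pulled by the other player, but not the other's reward. A pure strategy maps a player's past observations (both players' past arms and the player's own past rewards) to the next arm; a mixed strategy is a probability distribution over pure strategies, and the two players randomize independently. Let $\gamma_i(t)$ be the reward of player $i$ in round $t$, let $\beta\in(0,1)$ be the discount factor and $\Gamma_i=\sum_{t\ge0}\beta^t\gamma_i(t)$. In the zero-sum game ($\lambda=-1$) Alice's utility is $\Gamma_A-\Gamma_B$ and Bob's is $\Gamma_B-\Gamma_A$. A pair of mixed strategies is a Nash equilibrium if each maximizes its player's expected utility against the other. Let $g=g(\mu,\beta)$ be the Gittins index of arm $R$: the infimum of the $p\in[0,1]$ for which always pulling $L$ maximizes the expected total discounted reward of a single player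 facing the same two arms. Let $$p^*=p^*(\mu,\beta,-1)=\sup\{p\in[0,1] : \text{in some Nash equilibrium of the zero-sum game, with positive probability some player pulls } R \text{ in some round}\}.$$ **Theorem 1.** The set in the definition of $p^*$ is non-empty, and $$p^*\le\frac{m\beta+g}{1+\beta}<g.$$ In particular $p^*<g$. Moreover, for every $p\in[0,1]$ with $p>p^*$ and every Nash equilibrium of the zero-sum game, with probability $1$ neither player ever pulls arm $R$. -/

import Mathlib

open MeasureTheory Set
open scoped unitInterval

noncomputable section

namespace Bandit

/-- The two arms: the predictable left arm `L` and the risky right arm `R`. -/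
inductive Arm
  | L
  | R
  deriving DecidableEq

instance : Fintype Arm where
  elems := {Arm.L, Arm.R}
  complete a := by cases a <;> decide

instance : MeasurableSpace Arm := ⊤

/-- The two players. -/
inductive Player
  | alice
  | bob
  deriving DecidableEq

instance : Fintype Player where
  elems := {Player.alice, Player.bob}
  complete i := by cases i <;> decide

/-- The success probability of each arm, when the left arm has success probability `p` and the
success probability of the right arm is `θ`. -/
def successProb (p : ℝ) (θ : I) : Arm → ℝ
  | Arm.L => p
  | Arm.R => θ

/-- A reward bit, seen as a real number. -/
def bitValue (b : Bool) : ℝ := if b then 1 else 0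

/-- The mean of the prior. -/
def priorMean (μ : Measure I) : ℝ := ∫ x, (x : ℝ) ∂μ

/-! ### The single-player one-armed bandit -/

/-- A pure strategy of a single player: the next arm as a function of the history of (arm pulled,
reward obtained), listed with the most recent round first. -/
abbrev SoloStrategy := List (Arm × Bool) → Arm

/-- The randomness of the rewards: for every round and every arm a point of `[0,1]`. Pulling an
arm of success probability `q` gives reward `1` when this point is less than `q`. -/
abbrev SoloCoins := ℕ → Arm → I

/-- The points are independent and uniform in `[0,1]`. -/
def soloCoinLaw : Measure SoloCoins := Measure.infinitePi fun _ => (volume : Measure (Arm → I))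

/-- The history of the single player before round `t`. -/
def soloHistory (p : ℝ) (S : SoloStrategy) (θ : I) (u : SoloCoins) : ℕ → List (Arm × Bool)
  | 0 => []
  | t + 1 =>
      let h := soloHistory p S θ u t
      (S h, decide ((u t (S h) : ℝ) < successProb p θ (S h))) :: h

/-- The reward of the single player in round `t`. -/
def soloReward (p : ℝ) (S : SoloStrategy) (θ : I) (u : SoloCoins) (t : ℕ) : ℝ :=
  let a := S (soloHistory p S θ u t)
  bitValue (decide ((u t a : ℝ) < successProb p θ a))

/-- The total discounted reward of the single player. -/
def soloTotal (β p : ℝ) (S : SoloStrategy) (θ : I) (u : SoloCoins) : ℝ :=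
  ∑' t, soloReward p S θ u t * β ^ t

/-- The expected total discounted reward of a mixed strategy of the single player. -/
def soloValue (μ : Measure I) (β p : ℝ) (τ : ProbabilityMeasure SoloStrategy) : ℝ :=
  ∫ ω, soloTotal β p ω.1 ω.2.1 ω.2.2
    ∂((τ : Measure SoloStrategy).prod (μ.prod soloCoinLaw))

/-- The strategy of pulling the left arm in every round. -/
def alwaysLeft : SoloStrategy := fun _ => Arm.L

/-- Pulling the left arm in every round is optimal for a single player. -/
def AlwaysLeftOptimal (μ : Measure I) (β p : ℝ) : Prop :=
  ∀ τ : ProbabilityMeasure SoloStrategy, soloValue μ β p τ ≤ soloValue μ β p (diracProba alwaysLeft)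

/-- The Gittins index of the right arm: the infimum of the success probabilities of the left arm
for which always pulling the left arm is optimal for a single player. -/
def gittinsIndex (μ : Measure I) (β : ℝ) : ℝ :=
  sInf {p : ℝ | p ∈ Icc (0 : ℝ) 1 ∧ AlwaysLeftOptimal μ β p}

/-! ### The two-player game -/

/-- What a player sees in one round: their own arm, the arm of the other player, and their own
reward. -/
abbrev Obs := Arm × Arm × Bool

/-- A pure strategy: the next arm as a function of the observations so far, listed with the most
recent round first. -/
abbrev PureStrategy := List Obs → Arm

/-- A mixed strategy: a probability distribution over pure strategies. -/
abbrev MixedStrategy := ProbabilityMeasure PureStrategy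

/-- The two ways in which the rewards of the players are drawn, given the success probabilities,
when both pull the same arm in the same round: each player gets an independent draw, or the arm
produces one reward in that round and both players receive it. -/
inductive DrawModel
  | separate
  | shared

/-- The player whose points decide the reward of player `i`. -/
def DrawModel.source : DrawModel → Player → Player
  | DrawModel.separate, i => i
  | DrawModel.shared, _ => Player.alice

/-- The randomness of the rewards: for every round, arm and player a point of `[0,1]`. -/
abbrev Coins := ℕ → Arm × Player → I

/-- The points are independent and uniform in `[0,1]`. -/
def coinLaw : Measure Coins := Measure.infinitePi fun _ => (volume : Measure (Arm × Player → I))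

/-- The reward bit that player `i` gets in round `t` from pulling arm `a`. -/
def drawBit (D : DrawModel) (p : ℝ) (θ : I) (u : Coins) (i : Player) (t : ℕ) (a : Arm) : Bool :=
  decide ((u t (a, D.source i) : ℝ) < successProb p θ a)

/-- The realization of all the randomness: the pure strategies of Alice and Bob, the success
probability of the right arm, and the points that decide the rewards. -/
abbrev Sample := PureStrategy × PureStrategy × I × Coins

/-- The histories of Alice and Bob before round `t`. -/
def histories (D : DrawModel) (p : ℝ) (ω : Sample) : ℕ → List Obs × List Obs
  | 0 => ([], [])
  | t + 1 =>
      let h := histories D p ω t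
      let a := ω.1 h.1
      let b := ω.2.1 h.2
      ((a, b, drawBit D p ω.2.2.1 ω.2.2.2 Player.alice t a) :: h.1,
       (b, a, drawBit D p ω.2.2.1 ω.2.2.2 Player.bob t b) :: h.2)

/-- The arm that player `i` pulls in round `t`. -/
def armPulled (D : DrawModel) (p : ℝ) (ω : Sample) (t : ℕ) : Player → Arm
  | Player.alice => ω.1 (histories D p ω t).1
  | Player.bob => ω.2.1 (histories D p ω t).2

/-- The reward of player `i` in round `t`. -/
def reward (D : DrawModel) (p : ℝ) (ω : Sample) (i : Player) (t : ℕ) : ℝ :=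
  bitValue (drawBit D p ω.2.2.1 ω.2.2.2 i t (armPulled D p ω t i))

/-- The total discounted reward of player `i`. -/
def totalReward (D : DrawModel) (β p : ℝ) (ω : Sample) (i : Player) : ℝ :=
  ∑' t, reward D p ω i t * β ^ t

/-- The joint law of the randomness when the players use the mixed strategies `σA` and `σB`:
the two players randomize independently of each other and of Nature. -/
def gameLaw (μ : Measure I) (σA σB : MixedStrategy) : Measure Sample :=
  (σA : Measure PureStrategy).prod ((σB : Measure PureStrategy).prod (μ.prod coinLaw))

/-- Alice's expected utility, with cooperation parameter `l`. -/
def utilityA (D : DrawModel) (μ : Measure I) (β l p : ℝ) (σA σB : MixedStrategy) : ℝ :=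
  ∫ ω, (totalReward D β p ω Player.alice + l * totalReward D β p ω Player.bob) ∂gameLaw μ σA σB

/-- Bob's expected utility, with cooperation parameter `l`. -/
def utilityB (D : DrawModel) (μ : Measure I) (β l p : ℝ) (σA σB : MixedStrategy) : ℝ :=
  ∫ ω, (totalReward D β p ω Player.bob + l * totalReward D β p ω Player.alice) ∂gameLaw μ σA σB

/-- `(σA, σB)` is a (Bayesian) Nash equilibrium: each strategy is a best response to the other. -/
def IsNash (D : DrawModel) (μ : Measure I) (β l p : ℝ) (σA σB : MixedStrategy) : Prop :=
  (∀ τ : MixedStrategy, utilityA D μ β l p τ σB ≤ utilityA D μ β l p σA σB) ∧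
  (∀ τ : MixedStrategy, utilityB D μ β l p σA τ ≤ utilityB D μ β l p σA σB)

/-- Some player pulls the right arm in some round. -/
def Explored (D : DrawModel) (p : ℝ) (ω : Sample) : Prop :=
  ∃ (t : ℕ) (i : Player), armPulled D p ω t i = Arm.R

/-- The success probabilities of the left arm for which the right arm is explored, with positive
probability, in some Nash equilibrium. -/
def exploringSet (D : DrawModel) (μ : Measure I) (β l : ℝ) : Set ℝ :=
  {p : ℝ | p ∈ Icc (0 : ℝ) 1 ∧ ∃ σA σB : MixedStrategy, IsNash D μ β l p σA σB ∧
    0 < gameLaw μ σA σB {ω | Explored D p ω}}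

/-- The threshold `p*`. -/
def pStar (D : DrawModel) (μ : Measure I) (β l : ℝ) : ℝ := sSup (exploringSet D μ β l)

end Bandit

end

noncomputable section

namespace Bandit

/-! ### Measure-theoretic preliminaries -/

/-! The proof rests on one strategy, `copyStrategy`: repeat the opponent's pulls of `R` one round
later, all except the first one. Let W be the opponent's discounted number of pulls of `R`, and let
E be β^τ, where τ is the round of the opponent's first pull of `R` (E = 0 if there is none). In
expectation, rewards may be replaced by success probabilities. The opponent's lead over the copier
is then the mean of (θ - p)(W - β(W - E)) = (1 - β)(θ - p)W + β(θ - p)E.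

Two facts bound this lead. First, nothing that is seen before round τ depends on θ, so the second
term has mean β(m - p)·𝔼E (`integral_mul_firstPull`): the first experiment is not copied, and for p
> m it costs the experimenter. Second, if always pulling `L` is optimal against a left arm of
probability q, then 𝔼[(θ - q)W] ≤ 0 for every strategy, even one played with a left arm of
probability p, because rewards of the left arm carry no information and can be simulated
(`integral_rightPulls_nonpos`). Together with (1 - β)W ≤ E, the lead is at most (max(q - p, 0) - β(p
- m))·𝔼E (`integral_advantage_le`). For p > (mβ + g)/(1 + β), some q close to g makes this factor
negative.

In an equilibrium of the zero-sum game neither player gains by deviating to copying, which squeezes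
the value to 0 and forces 𝔼E = 0 for both strategies. So neither strategy ever pulls `R` against the
copier, who then never pulls it either; the two strategies see the same thing when they meet, and
`R` stays unexplored (`ae_not_explored_of_isNash`).

The strict inequality m < g comes from trying `R` once and keeping it after a success, which pays
because θ has positive variance. The set that defines p* contains 0, where always pulling `R` is an
equilibrium. -/

theorem integrable_of_abs_le {X : Type*} [MeasurableSpace X] {P : Measure X} [IsFiniteMeasure P]
    {f : X → ℝ} {C : ℝ} (hf : Measurable f) (h : ∀ x, |f x| ≤ C) : Integrable f P :=
  Integrable.of_bound hf.aestronglyMeasurable C (ae_of_all _ h)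

/-- Replacing one coordinate by an independent copy preserves the law of an i.i.d. sequence. -/
theorem measurePreserving_update {Y : Type*} [MeasurableSpace Y] (ν : Measure Y)
    [IsProbabilityMeasure ν] (t : ℕ) :
    MeasurePreserving (fun z : (ℕ → Y) × Y => Function.update z.1 t z.2)
      ((Measure.infinitePi fun _ : ℕ => ν).prod ν) (Measure.infinitePi fun _ : ℕ => ν) := by
  have hm : Measurable (fun z : (ℕ → Y) × Y => Function.update z.1 t z.2) := by
    refine measurable_pi_lambda _ fun s => ?_
    by_cases h : s = t
    · subst h; simpa using measurable_snd
    · simp only [Function.update_of_ne h]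
      fun_prop
  refine ⟨hm, Measure.eq_infinitePi _ fun s B hB => ?_⟩
  rw [Measure.map_apply hm (.pi s.countable_toSet fun _ _ => hB _)]
  by_cases hts : t ∈ s
  · have : (fun z : (ℕ → Y) × Y => Function.update z.1 t z.2) ⁻¹' ((s : Set ℕ).pi B)
        = (((s.erase t : Finset ℕ) : Set ℕ).pi B) ×ˢ (B t) := by
      ext ⟨x, y⟩
      simp only [mem_preimage, Set.mem_pi, Finset.mem_coe, mem_prod, Finset.mem_erase]
      constructor
      · intro h
        exact ⟨fun i hi => by simpa [hi.1] using h i hi.2, by simpa using h t hts⟩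
      · rintro ⟨h1, h2⟩ i hi
        by_cases hit : i = t
        · subst hit; simpa using h2
        · simpa [hit] using h1 i ⟨hit, hi⟩
    rw [this, Measure.prod_prod, Measure.infinitePi_pi _ fun i _ => hB i,
      Finset.prod_erase_mul _ _ hts]
  · have : (fun z : (ℕ → Y) × Y => Function.update z.1 t z.2) ⁻¹' ((s : Set ℕ).pi B)
        = ((s : Set ℕ).pi B) ×ˢ univ := by
      ext ⟨x, y⟩
      simp only [mem_preimage, Set.mem_pi, Finset.mem_coe, mem_prod, mem_univ, and_true]
      refine forall₂_congr fun i hi => ?_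
      rw [Function.update_of_ne (by rintro rfl; exact hts hi)]
    rw [this, Measure.prod_prod, Measure.infinitePi_pi _ fun i _ => hB i]
    simp

/-- Taking some of the coordinates from an independent copy preserves a product law. -/
theorem measurePreserving_piecewise {K Y : Type*} [MeasurableSpace Y] (ν : Measure Y)
    [IsProbabilityMeasure ν] (A : K → Prop) [DecidablePred A] :
    MeasurePreserving (fun z : (K → Y) × (K → Y) => fun k => if A k then z.1 k else z.2 k)
      ((Measure.infinitePi fun _ : K => ν).prod (Measure.infinitePi fun _ : K => ν))
      (Measure.infinitePi fun _ : K => ν) := by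
  have hm : Measurable
      (fun z : (K → Y) × (K → Y) => fun k => if A k then z.1 k else z.2 k) := by
    refine measurable_pi_lambda _ fun k => ?_
    by_cases h : A k <;> simp only [h, if_true, if_false] <;> fun_prop
  refine ⟨hm, Measure.eq_infinitePi _ fun s B hB => ?_⟩
  rw [Measure.map_apply hm (.pi s.countable_toSet fun _ _ => hB _)]
  have : (fun z : (K → Y) × (K → Y) => fun k => if A k then z.1 k else z.2 k) ⁻¹'
      ((s : Set K).pi B)
      = (((s.filter A : Finset K) : Set K).pi B) ×ˢ
        (((s.filter fun k => ¬ A k : Finset K) : Set K).pi B) := by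
    ext ⟨x, y⟩
    simp only [mem_preimage, Set.mem_pi, Finset.mem_coe, mem_prod, Finset.mem_filter]
    constructor
    · intro h
      exact ⟨fun i hi => by simpa [hi.2] using h i hi.1, fun i hi => by simpa [hi.2] using h i hi.1⟩
    · rintro ⟨h1, h2⟩ i hi
      by_cases hA : A i
      · simpa [hA] using h1 i ⟨hi, hA⟩
      · simpa [hA] using h2 i ⟨hi, hA⟩
  rw [this, Measure.prod_prod, Measure.infinitePi_pi _ fun i _ => hB i,
    Measure.infinitePi_pi _ fun i _ => hB i, Finset.prod_filter_mul_prod_filter_not]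

theorem measurePreserving_curry (J : Type*) [Fintype J] :
    MeasurePreserving (fun (z : ℕ × J → I) (t : ℕ) (j : J) => z (t, j))
      (Measure.infinitePi fun _ => (volume : Measure I))
      (Measure.infinitePi fun _ => (volume : Measure (J → I))) := by
  refine ⟨by fun_prop, ?_⟩
  have h := Measure.infinitePi_map_curry (fun (_ : ℕ) (_ : J) => (volume : Measure I))
  simp only [Measure.infinitePi_eq_pi] at h
  exact h

theorem measurePreserving_uncurry (J : Type*) [Fintype J] :
    MeasurePreserving (fun (z : ℕ → J → I) (k : ℕ × J) => z k.1 k.2)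
      (Measure.infinitePi fun _ => (volume : Measure (J → I)))
      (Measure.infinitePi fun _ => (volume : Measure I)) := by
  refine ⟨by fun_prop, ?_⟩
  have h := Measure.infinitePi_map_curry_symm (fun (_ : ℕ) (_ : J) => (volume : Measure I))
  simp only [Measure.infinitePi_eq_pi] at h
  exact h

theorem measurePreserving_comp_injective {J J' : Type*} [Fintype J] [Fintype J'] {f : J' → J}
    (hf : Function.Injective f) :
    MeasurePreserving (fun (z : ℕ → J → I) (t : ℕ) (j : J') => z t (f j))
      (Measure.infinitePi fun _ => (volume : Measure (J → I)))
      (Measure.infinitePi fun _ => (volume : Measure (J' → I))) := by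
  refine ⟨by fun_prop, ?_⟩
  have hm : Measurable (fun (y : J → I) (j : J') => y (f j)) := by fun_prop
  have key : (volume : Measure (J → I)).map (fun (y : J → I) (j : J') => y (f j)) = volume := by
    have := Measure.map_infinitePi_infinitePi_of_inj (P := fun _ : J => (volume : Measure I)) hf
    simp only [Measure.infinitePi_eq_pi] at this
    exact this
  rw [Measure.infinitePi_map_pi (fun _ : ℕ => (volume : Measure (J → I))) (fun _ => hm)]
  simp only [key]

/-- Arms and histories take countably many values, so a quantity read off at a random arm or history
is measurable as soon as it is so for each fixed one. All measurability proofs along the recursion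
of play use this. -/
theorem measurable_comp_countable {X Y Z : Type*} [MeasurableSpace X] [MeasurableSpace Y]
    [MeasurableSpace Z] [Countable Z] [MeasurableSingletonClass Z] {f : Z → X → Y} {g : X → Z}
    (hf : ∀ z, Measurable (f z)) (hg : Measurable g) : Measurable fun x => f (g x) x :=
  (measurable_from_prod_countable_right (f := fun q : Z × X => f q.1 q.2) hf).comp
    (hg.prodMk measurable_id)

theorem measurable_decide_lt {X : Type*} [MeasurableSpace X] {f g : X → ℝ}
    (hf : Measurable f) (hg : Measurable g) : Measurable fun x => decide (f x < g x) :=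
  measurable_to_bool (by simpa [preimage] using measurableSet_lt hf hg)

@[fun_prop]
theorem measurable_bitValue : Measurable bitValue := measurable_from_top

theorem abs_bitValue_le (b : Bool) : |bitValue b| ≤ 1 := by
  cases b <;> simp [bitValue]

theorem integral_bitValue_lt {c : ℝ} (hc : c ∈ Icc (0 : ℝ) 1) :
    ∫ y : I, bitValue (decide ((y : ℝ) < c)) = c := by
  have : (fun y : I => bitValue (decide ((y : ℝ) < c)))
      = (Iio (⟨c, hc⟩ : I)).indicator (fun _ => (1 : ℝ)) := by
    ext y
    simp [bitValue, indicator, ← Subtype.coe_lt_coe]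
  rw [this, integral_indicator measurableSet_Iio]
  simp [Measure.real, unitInterval.volume_Iio, hc.1]

/-- If the choice `a` does not depend on the points of round `t`, then the expected reward of
the chosen option in round `t` is its success probability. -/
theorem integral_bitValue_of_adapted {J : Type*} [Fintype J] [MeasurableSpace J]
    [MeasurableSingletonClass J] {c : J → ℝ} (hc : ∀ j, c j ∈ Icc (0 : ℝ) 1) (t : ℕ)
    {a : (ℕ → J → I) → J} (ha : Measurable a)
    (had : ∀ u y, a (Function.update u t y) = a u) :
    ∫ u, bitValue (decide ((u t (a u) : ℝ) < c (a u)))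
        ∂(Measure.infinitePi fun _ : ℕ => (volume : Measure (J → I)))
      = ∫ u, c (a u) ∂(Measure.infinitePi fun _ : ℕ => (volume : Measure (J → I))) := by
  set P := Measure.infinitePi fun _ : ℕ => (volume : Measure (J → I))
  -- Resample the points of round `t`. The law is unchanged and so is the choice `a`, hence the
  -- fresh points can be integrated out with the chosen option held fixed.
  have hmp : MeasurePreserving _ (P.prod volume) P :=
    measurePreserving_update (volume : Measure (J → I)) t
  have hF : Measurable fun u : ℕ → J → I => bitValue (decide ((u t (a u) : ℝ) < c (a u))) :=
    measurable_comp_countable (f := fun j (u : ℕ → J → I) => bitValue (decide ((u t j : ℝ) < c j)))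
      (fun j => measurable_bitValue.comp (measurable_decide_lt (by fun_prop) (by fun_prop))) ha
  have hint : Integrable (fun z : (ℕ → J → I) × (J → I) => (fun u : ℕ → J → I =>
      bitValue (decide ((u t (a u) : ℝ) < c (a u)))) (Function.update z.1 t z.2))
      (P.prod volume) := integrable_of_abs_le (hF.comp hmp.measurable) fun _ => abs_bitValue_le _
  calc _ = ∫ u : ℕ → J → I, bitValue (decide ((u t (a u) : ℝ) < c (a u)))
        ∂((P.prod volume).map fun z => Function.update z.1 t z.2) := by rw [hmp.map_eq]
    _ = _ := integral_map hmp.measurable.aemeasurable hF.aestronglyMeasurable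
    _ = _ := integral_prod _ hint
    _ = _ := ?_
  refine integral_congr_ae (ae_of_all _ fun u => ?_)
  simp only [had, Function.update_self]
  have he : MeasurePreserving (fun y : J → I => y (a u)) volume volume :=
    measurePreserving_eval (fun _ : J => (volume : Measure I)) (a u)
  have hb : Measurable fun y : I => bitValue (decide ((y : ℝ) < c (a u))) :=
    measurable_bitValue.comp (measurable_decide_lt (by fun_prop) (by fun_prop))
  have h1 := integral_map (μ := (volume : Measure (J → I))) he.measurable.aemeasurable
    hb.aestronglyMeasurable
  rw [he.map_eq, integral_bitValue_lt (hc (a u))] at h1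
  exact h1.symm

/-! ### Discounted sums -/

/-- The discounted sum of a sequence. -/
def discount (β : ℝ) (f : ℕ → ℝ) : ℝ := ∑' t, f t * β ^ t

section Discount

variable {β : ℝ} {f g : ℕ → ℝ} {C : ℝ}

theorem summable_discount (hβ0 : 0 < β) (hβ1 : β < 1) (hf : ∀ t, |f t| ≤ C) :
    Summable fun t => f t * β ^ t := by
  refine Summable.of_norm_bounded (g := fun t => C * β ^ t)
    ((summable_geometric_of_lt_one hβ0.le hβ1).mul_left C) fun t => ?_
  rw [Real.norm_eq_abs, abs_mul, abs_of_pos (pow_pos hβ0 t)]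
  exact mul_le_mul_of_nonneg_right (hf t) (pow_pos hβ0 t).le

theorem abs_discount_le (hβ0 : 0 < β) (hβ1 : β < 1) (hf : ∀ t, |f t| ≤ C) :
    |discount β f| ≤ C * (1 - β)⁻¹ := by
  rw [← Real.norm_eq_abs]
  refine tsum_of_norm_bounded ((hasSum_geometric_of_lt_one hβ0.le hβ1).mul_left C) fun t => ?_
  rw [Real.norm_eq_abs, abs_mul, abs_of_pos (pow_pos hβ0 t)]
  exact mul_le_mul_of_nonneg_right (hf t) (pow_pos hβ0 t).le

theorem discount_const (hβ0 : 0 < β) (hβ1 : β < 1) (x : ℝ) :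
    discount β (fun _ => x) = x * (1 - β)⁻¹ :=
  ((hasSum_geometric_of_lt_one hβ0.le hβ1).mul_left x).tsum_eq

theorem discount_add_mul (hβ0 : 0 < β) (hβ1 : β < 1) (hf : ∀ t, |f t| ≤ C) (hg : ∀ t, |g t| ≤ C)
    (x y : ℝ) : discount β (fun t => x * f t + y * g t) = x * discount β f + y * discount β g := by
  unfold discount
  rw [← tsum_mul_left, ← tsum_mul_left, ← Summable.tsum_add
    ((summable_discount hβ0 hβ1 hf).mul_left x) ((summable_discount hβ0 hβ1 hg).mul_left y)]
  exact tsum_congr fun t => by ring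

theorem discount_mono (hβ0 : 0 < β) (hβ1 : β < 1) (hf : ∀ t, |f t| ≤ C) (hg : ∀ t, |g t| ≤ C)
    (h : ∀ t, f t ≤ g t) : discount β f ≤ discount β g :=
  Summable.tsum_le_tsum (fun t => mul_le_mul_of_nonneg_right (h t) (pow_pos hβ0 t).le)
    (summable_discount hβ0 hβ1 hf) (summable_discount hβ0 hβ1 hg)

theorem discount_succ (hβ0 : 0 < β) (hβ1 : β < 1) (hf : ∀ t, |f t| ≤ C) :
    discount β f = f 0 + β * discount β (fun t => f (t + 1)) := by
  unfold discount
  rw [(summable_discount hβ0 hβ1 hf).tsum_eq_zero_add, ← tsum_mul_left]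
  simp only [pow_zero, mul_one]
  congr 1
  exact tsum_congr fun t => by ring

theorem discount_eq_zero (hβ0 : 0 < β) (hβ1 : β < 1) (hf : ∀ t, |f t| ≤ C) (h0 : ∀ t, 0 ≤ f t)
    (h : discount β f = 0) (t : ℕ) : f t = 0 := by
  have h1 := (hasSum_zero_iff_of_nonneg (f := fun t => f t * β ^ t)
    fun t => mul_nonneg (h0 t) (pow_pos hβ0 t).le).1 (by
      have := (summable_discount hβ0 hβ1 hf).hasSum
      unfold discount at h
      rwa [h] at this)
  have := congrFun h1 t
  simpa [(pow_pos hβ0 t).ne'] using this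

variable {X : Type*} [MeasurableSpace X] {F G : ℕ → X → ℝ}

theorem measurable_discount (hβ0 : 0 < β) (hβ1 : β < 1) (hF : ∀ t, Measurable (F t))
    (hC : ∀ t x, |F t x| ≤ C) : Measurable fun x => discount β (fun t => F t x) := by
  refine measurable_of_tendsto_metrizable
    (f := fun n x => ∑ t ∈ Finset.range n, F t x * β ^ t) (fun n => ?_) ?_
  · exact Finset.measurable_fun_sum _ fun t _ => (hF t).mul_const _
  · rw [tendsto_pi_nhds]
    exact fun x => (summable_discount hβ0 hβ1 fun t => hC t x).hasSum.tendsto_sum_nat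

theorem integrable_discount {P : Measure X} [IsFiniteMeasure P] (hβ0 : 0 < β) (hβ1 : β < 1)
    (hF : ∀ t, Measurable (F t)) (hC : ∀ t x, |F t x| ≤ C) :
    Integrable (fun x => discount β (fun t => F t x)) P :=
  integrable_of_abs_le (measurable_discount hβ0 hβ1 hF hC)
    fun x => abs_discount_le hβ0 hβ1 fun t => hC t x

theorem integral_discount {P : Measure X} [IsFiniteMeasure P] (hβ0 : 0 < β) (hβ1 : β < 1)
    (hF : ∀ t, Measurable (F t)) (hC : ∀ t x, |F t x| ≤ C) :
    ∫ x, discount β (fun t => F t x) ∂P = discount β (fun t => ∫ x, F t x ∂P) := by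
  unfold discount
  rw [← integral_tsum_of_summable_integral_norm]
  · exact tsum_congr fun t => integral_mul_const _ _
  · exact fun t => (integrable_of_abs_le (hF t) (hC t)).mul_const _
  · refine Summable.of_nonneg_of_le (fun t => integral_nonneg fun x => norm_nonneg _) (fun t => ?_)
      ((summable_geometric_of_lt_one hβ0.le hβ1).mul_left (C * P.real univ))
    calc ∫ x, ‖F t x * β ^ t‖ ∂P ≤ ∫ x, C * β ^ t ∂P := by
          refine integral_mono ((integrable_of_abs_le (hF t) (hC t)).mul_const _).norm
            (integrable_const _) fun x => ?_
          simp only [Real.norm_eq_abs, abs_mul, abs_of_pos (pow_pos hβ0 t)]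
          exact mul_le_mul_of_nonneg_right (hC t x) (pow_pos hβ0 t).le
      _ = _ := by simp; ring

end Discount

-- The histories used below form countable types, so the discrete σ-algebra is harmless and makes
-- every function of a history measurable.
local instance listMeasurableSpace {α : Type*} : MeasurableSpace (List α) := ⊤

instance : Countable Arm := Finite.to_countable

/-! ### The single player -/

/-- The indicator of the right arm. -/
def rightInd (a : Arm) : ℝ := if a = Arm.R then 1 else 0

theorem rightInd_nonneg (a : Arm) : 0 ≤ rightInd a := by
  unfold rightInd; split_ifs <;> norm_num

theorem abs_rightInd_le (a : Arm) : |rightInd a| ≤ 1 := by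
  unfold rightInd; split_ifs <;> norm_num

theorem successProb_eq (p : ℝ) (θ : I) (a : Arm) :
    successProb p θ a = p + (θ - p) * rightInd a := by
  cases a <;> simp [successProb, rightInd]

theorem successProb_mem {p : ℝ} (hp : p ∈ Icc (0 : ℝ) 1) (θ : I) (a : Arm) :
    successProb p θ a ∈ Icc (0 : ℝ) 1 := by
  cases a
  · exact hp
  · exact θ.2

theorem abs_successProb_le {p : ℝ} (hp : p ∈ Icc (0 : ℝ) 1) (θ : I) (a : Arm) :
    |successProb p θ a| ≤ 1 := by
  have := successProb_mem hp θ a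
  rw [abs_of_nonneg this.1]
  exact this.2

theorem measurable_successProb (p : ℝ) (a : Arm) : Measurable fun θ : I => successProb p θ a := by
  cases a <;> simp only [successProb] <;> fun_prop

theorem abs_sub_le_one {p : ℝ} (hp : p ∈ Icc (0 : ℝ) 1) (θ : I) : |(θ : ℝ) - p| ≤ 1 := by
  rw [abs_le]; constructor <;> linarith [θ.2.1, θ.2.2, hp.1, hp.2]

instance : IsProbabilityMeasure soloCoinLaw := by unfold soloCoinLaw; infer_instance

instance : IsProbabilityMeasure coinLaw := by unfold coinLaw; infer_instance

/-- The arm that the single player pulls in round `t`. -/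
def soloArm (p : ℝ) (S : SoloStrategy) (θ : I) (v : SoloCoins) (t : ℕ) : Arm :=
  S (soloHistory p S θ v t)

/-- The bit that tells whether `x < y`. -/
def ltBit (x y : ℝ) : Bool := decide (x < y)

theorem soloHistory_succ (p : ℝ) (S : SoloStrategy) (θ : I) (v : SoloCoins) (t : ℕ) :
    soloHistory p S θ v (t + 1) = (soloArm p S θ v t,
      ltBit (v t (soloArm p S θ v t)) (successProb p θ (soloArm p S θ v t))) ::
        soloHistory p S θ v t := rfl

theorem length_soloHistory (p : ℝ) (S : SoloStrategy) (θ : I) (v : SoloCoins) (t : ℕ) :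
    (soloHistory p S θ v t).length = t := by
  induction t with
  | zero => rfl
  | succ t ih => rw [soloHistory_succ, List.length_cons, ih]

theorem soloHistory_congr (p : ℝ) (S : SoloStrategy) (θ : I) {v v' : SoloCoins} {t : ℕ}
    (h : ∀ s < t, v s = v' s) : soloHistory p S θ v t = soloHistory p S θ v' t := by
  induction t with
  | zero => rfl
  | succ t ih =>
    have := ih fun s hs => h s (hs.trans t.lt_succ_self)
    simp only [soloHistory_succ, soloArm, this, h t t.lt_succ_self]

theorem measurable_soloHistory (p : ℝ) (t : ℕ) :
    Measurable fun x : SoloStrategy × I × SoloCoins => soloHistory p x.1 x.2.1 x.2.2 t := by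
  induction t with
  | zero => exact measurable_const
  | succ t ih =>
    refine measurable_comp_countable
      (f := fun h (x : SoloStrategy × I × SoloCoins) => ((x.1 h,
        decide ((x.2.2 t (x.1 h) : ℝ) < successProb p x.2.1 (x.1 h))) :: h)) (fun h => ?_) ih
    refine measurable_comp_countable
      (f := fun a (x : SoloStrategy × I × SoloCoins) => ((a,
        decide ((x.2.2 t a : ℝ) < successProb p x.2.1 a)) :: h)) (fun a => ?_) (by fun_prop)
    exact (measurable_from_top (f := fun b : Bool => (a, b) :: h)).comp
      (measurable_decide_lt (by fun_prop)
        ((measurable_successProb p a).comp (by fun_prop)))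

theorem measurable_soloArm (p : ℝ) (t : ℕ) :
    Measurable fun x : SoloStrategy × I × SoloCoins => soloArm p x.1 x.2.1 x.2.2 t :=
  measurable_comp_countable (f := fun h (x : SoloStrategy × I × SoloCoins) => x.1 h)
    (fun h => by fun_prop) (measurable_soloHistory p t)

theorem measurable_rightInd : Measurable rightInd := measurable_from_top

/-- The discounted number of pulls of the right arm. -/
def rightPulls (β p : ℝ) (S : SoloStrategy) (θ : I) (v : SoloCoins) : ℝ :=
  discount β fun t => rightInd (soloArm p S θ v t)

theorem measurable_rightPulls {β : ℝ} (hβ0 : 0 < β) (hβ1 : β < 1) (p : ℝ) :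
    Measurable fun x : SoloStrategy × I × SoloCoins => rightPulls β p x.1 x.2.1 x.2.2 :=
  measurable_discount hβ0 hβ1 (fun t => measurable_rightInd.comp (measurable_soloArm p t))
    (fun _ _ => abs_rightInd_le _)

theorem abs_rightPulls_le {β : ℝ} (hβ0 : 0 < β) (hβ1 : β < 1) (p : ℝ) (S : SoloStrategy) (θ : I)
    (v : SoloCoins) : |rightPulls β p S θ v| ≤ 1 * (1 - β)⁻¹ :=
  abs_discount_le hβ0 hβ1 fun _ => abs_rightInd_le _

theorem measurable_solo_pair {Y : Type*} [MeasurableSpace Y]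
    {F : SoloStrategy × I × SoloCoins → Y} (hF : Measurable F) (S : SoloStrategy) :
    Measurable fun z : I × SoloCoins => F (S, z.1, z.2) :=
  hF.comp (by fun_prop)

theorem measurable_soloReward (p : ℝ) (t : ℕ) :
    Measurable fun x : SoloStrategy × I × SoloCoins => soloReward p x.1 x.2.1 x.2.2 t :=
  measurable_comp_countable
    (f := fun a (x : SoloStrategy × I × SoloCoins) =>
      bitValue (decide ((x.2.2 t a : ℝ) < successProb p x.2.1 a)))
    (fun a => measurable_bitValue.comp (measurable_decide_lt (by fun_prop)
      ((measurable_successProb p a).comp (by fun_prop)))) (measurable_soloArm p t)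

theorem abs_soloReward_le (p : ℝ) (S : SoloStrategy) (θ : I) (v : SoloCoins) (t : ℕ) :
    |soloReward p S θ v t| ≤ 1 := abs_bitValue_le _

theorem integral_soloReward {p : ℝ} (hp : p ∈ Icc (0 : ℝ) 1) (S : SoloStrategy) (θ : I) (t : ℕ) :
    ∫ v, soloReward p S θ v t ∂soloCoinLaw
      = ∫ v, successProb p θ (soloArm p S θ v t) ∂soloCoinLaw := by
  refine integral_bitValue_of_adapted (c := successProb p θ) (successProb_mem hp θ) t
    (a := fun v => soloArm p S θ v t)
    ((measurable_soloArm p t).comp (f := fun v => (S, θ, v)) (by fun_prop)) fun v y => ?_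
  unfold soloArm
  rw [soloHistory_congr p S θ fun s hs => Function.update_of_ne hs.ne _ _]

variable {μ : Measure I} [IsProbabilityMeasure μ] {β : ℝ}

theorem measurable_successProb_soloArm (p : ℝ) (t : ℕ) :
    Measurable fun x : SoloStrategy × I × SoloCoins =>
      successProb p x.2.1 (soloArm p x.1 x.2.1 x.2.2 t) :=
  measurable_comp_countable (f := fun a (x : SoloStrategy × I × SoloCoins) =>
    successProb p x.2.1 a) (fun a => (measurable_successProb p a).comp (by fun_prop))
    (measurable_soloArm p t)

theorem discount_successProb (hβ0 : 0 < β) (hβ1 : β < 1) (p : ℝ) (θ : I) (a : ℕ → Arm) :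
    discount β (fun t => successProb p θ (a t))
      = p * (1 - β)⁻¹ + (θ - p) * discount β (fun t => rightInd (a t)) := by
  have := discount_add_mul (f := fun _ => 1) (g := fun t => rightInd (a t)) hβ0 hβ1 (C := 1)
    (by simp) (fun t => abs_rightInd_le _) p (θ - p)
  rw [discount_const hβ0 hβ1, one_mul] at this
  rw [← this]
  simp only [successProb_eq, mul_one]

/-- The arm of round `t` depends only on earlier coins, so each reward can be replaced by its
success probability; every pull of `R` then gains θ - p over the baseline p/(1 - β) of never leaving
`L`. -/
theorem soloValue_dirac (hβ0 : 0 < β) (hβ1 : β < 1) {p : ℝ} (hp : p ∈ Icc (0 : ℝ) 1)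
    (S : SoloStrategy) :
    soloValue μ β p (diracProba S) = p * (1 - β)⁻¹ +
      ∫ z, ((z.1 : ℝ) - p) * rightPulls β p S z.1 z.2 ∂(μ.prod soloCoinLaw) := by
  have hT : Measurable fun x : SoloStrategy × I × SoloCoins => soloTotal β p x.1 x.2.1 x.2.2 :=
    measurable_discount hβ0 hβ1 (measurable_soloReward p) (fun t x => abs_soloReward_le _ _ _ _ t)
  have hr : ∀ t, Measurable fun z : I × SoloCoins => soloReward p S z.1 z.2 t :=
    fun t => measurable_solo_pair (measurable_soloReward p t) S
  have hs : ∀ t, Measurable fun z : I × SoloCoins => successProb p z.1 (soloArm p S z.1 z.2 t) :=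
    fun t => measurable_solo_pair (measurable_successProb_soloArm p t) S
  have hi : Integrable (fun z : I × SoloCoins => ((z.1 : ℝ) - p) * rightPulls β p S z.1 z.2)
      (μ.prod soloCoinLaw) := by
    refine integrable_of_abs_le (C := 1 * (1 * (1 - β)⁻¹)) ((by fun_prop : Measurable _).mul
      (measurable_solo_pair (measurable_rightPulls hβ0 hβ1 p) S)) fun z => ?_
    rw [abs_mul]
    exact mul_le_mul (abs_sub_le_one hp _) (abs_rightPulls_le hβ0 hβ1 _ _ _ _) (abs_nonneg _)
      zero_le_one
  have h1 : soloValue μ β p (diracProba S)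
      = ∫ z, soloTotal β p S z.1 z.2 ∂(μ.prod soloCoinLaw) := by
    unfold soloValue
    have : ((diracProba S : ProbabilityMeasure SoloStrategy) : Measure SoloStrategy)
      = Measure.dirac S := rfl
    rw [this, Measure.dirac_prod, integral_map (by fun_prop) hT.aestronglyMeasurable]
  have h2 : ∀ t, ∫ z, soloReward p S z.1 z.2 t ∂(μ.prod soloCoinLaw)
      = ∫ z, successProb p z.1 (soloArm p S z.1 z.2 t) ∂(μ.prod soloCoinLaw) := fun t => by
    rw [integral_prod _ (integrable_of_abs_le (hr t) fun z => abs_soloReward_le _ _ _ _ t),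
      integral_prod _ (integrable_of_abs_le (hs t) fun z => abs_successProb_le hp _ _)]
    simp only [integral_soloReward hp]
  calc _ = _ := h1
    _ = discount β (fun t => ∫ z, soloReward p S z.1 z.2 t ∂(μ.prod soloCoinLaw)) :=
      integral_discount hβ0 hβ1 hr fun t z => abs_soloReward_le _ _ _ _ t
    _ = ∫ z, discount β (fun t => successProb p z.1 (soloArm p S z.1 z.2 t))
        ∂(μ.prod soloCoinLaw) := by
      simp only [h2]
      rw [integral_discount hβ0 hβ1 hs fun t z => abs_successProb_le hp _ _]
    _ = ∫ z, (p * (1 - β)⁻¹ + ((z.1 : ℝ) - p) * rightPulls β p S z.1 z.2)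
        ∂(μ.prod soloCoinLaw) := by
      simp only [discount_successProb hβ0 hβ1, rightPulls]
    _ = _ := by
      rw [integral_add (integrable_const _) hi]
      simp

theorem integral_rightPulls_nonpos_of_alwaysLeftOptimal (hβ0 : 0 < β) (hβ1 : β < 1) {p : ℝ}
    (hp : p ∈ Icc (0 : ℝ) 1) (h : AlwaysLeftOptimal μ β p) (S : SoloStrategy) :
    ∫ z, ((z.1 : ℝ) - p) * rightPulls β p S z.1 z.2 ∂(μ.prod soloCoinLaw) ≤ 0 := by
  have h1 := h (diracProba S)
  rw [soloValue_dirac hβ0 hβ1 hp, soloValue_dirac hβ0 hβ1 hp] at h1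
  have : ∀ z : I × SoloCoins, rightPulls β p alwaysLeft z.1 z.2 = 0 := fun z => by
    simp [rightPulls, soloArm, alwaysLeft, rightInd, discount]
  simp only [this, mul_zero, integral_zero] at h1
  linarith

/-! ### Simulating the left arm -/

/-- Replace the rewards of the left arm in a history by externally drawn ones. -/
def replaceLeft (p : ℝ) (v' : SoloCoins) : List (Arm × Bool) → List (Arm × Bool)
  | [] => []
  | (a, b) :: l =>
      (a, if a = Arm.L then ltBit (v' l.length Arm.L) p else b) :: replaceLeft p v' l

/-- The coins that take the left arm from `v'` and the right arm from `v`. -/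
def mixCoins (v' v : SoloCoins) : SoloCoins := fun t a => if a = Arm.L then v' t a else v t a

/-- Histories list the latest round first, so the length of the tail is the number of the round and
`replaceLeft` reads the coin of the right round. The success probability `q` of the actual left arm
drops out because its rewards are overwritten. -/
theorem soloHistory_mixCoins (p q : ℝ) (S : SoloStrategy) (θ : I) (v' v : SoloCoins) (t : ℕ) :
    soloHistory p S θ (mixCoins v' v) t
      = replaceLeft p v' (soloHistory q (fun h => S (replaceLeft p v' h)) θ v t) := by
  induction t with
  | zero => rfl
  | succ t ih =>
    simp only [soloHistory_succ, soloArm, replaceLeft, ← ih, length_soloHistory]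
    generalize S (soloHistory p S θ (mixCoins v' v) t) = a
    cases a <;> simp [mixCoins, successProb]

theorem rightPulls_mixCoins (p q : ℝ) (S : SoloStrategy) (θ : I) (v' v : SoloCoins) :
    rightPulls β p S θ (mixCoins v' v)
      = rightPulls β q (fun h => S (replaceLeft p v' h)) θ v := by
  simp only [rightPulls, soloArm, soloHistory_mixCoins p q]

/-- Over the flat index set of pairs (round, arm), each coordinate is taken from one of two
independent copies, which leaves an i.i.d. family. -/
theorem measurePreserving_mixCoins :
    MeasurePreserving (fun z : SoloCoins × SoloCoins => mixCoins z.1 z.2)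
      (soloCoinLaw.prod soloCoinLaw) soloCoinLaw := by
  have h := (measurePreserving_curry Arm).comp
    ((measurePreserving_piecewise (K := ℕ × Arm) (volume : Measure I) (fun k => k.2 = Arm.L)).comp
      ((measurePreserving_uncurry Arm).prod (measurePreserving_uncurry Arm)))
  exact h

/-- Play takes place with left arm `p`, while optimality is known for left arm `q`. A player facing
`q` can imitate the play by drawing the left rewards from private coins `v'`, and the bound holds
for each value of `v'`. -/
theorem integral_rightPulls_nonpos (hβ0 : 0 < β) (hβ1 : β < 1) {p q : ℝ}
    (hq : q ∈ Icc (0 : ℝ) 1) (h : AlwaysLeftOptimal μ β q) (S : SoloStrategy) :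
    ∫ z, ((z.1 : ℝ) - q) * rightPulls β p S z.1 z.2 ∂(μ.prod soloCoinLaw) ≤ 0 := by
  set F : I × SoloCoins → ℝ := fun z => ((z.1 : ℝ) - q) * rightPulls β p S z.1 z.2 with hFdef
  have hF : Measurable F := (by fun_prop : Measurable fun z : I × SoloCoins => (z.1 : ℝ) - q).mul
    (measurable_solo_pair (measurable_rightPulls hβ0 hβ1 p) S)
  have hFb : ∀ z, |F z| ≤ 1 * (1 * (1 - β)⁻¹) := fun z => by
    rw [hFdef, abs_mul]
    exact mul_le_mul (abs_sub_le_one hq _) (abs_rightPulls_le hβ0 hβ1 _ _ _ _) (abs_nonneg _)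
      zero_le_one
  have hmp : MeasurePreserving (fun z : I × SoloCoins × SoloCoins => (z.1, mixCoins z.2.1 z.2.2))
      (μ.prod (soloCoinLaw.prod soloCoinLaw)) (μ.prod soloCoinLaw) :=
    (MeasurePreserving.id μ).prod measurePreserving_mixCoins
  -- The private coins are moved to the outermost place: once they are fixed, the imitation is a
  -- pure strategy, to which optimality at `q` applies.
  have hsw : MeasurePreserving (fun z : SoloCoins × I × SoloCoins => (z.2.1, z.1, z.2.2))
      (soloCoinLaw.prod (μ.prod soloCoinLaw)) (μ.prod (soloCoinLaw.prod soloCoinLaw)) :=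
    (measurePreserving_prodAssoc μ soloCoinLaw soloCoinLaw).comp
      (((Measure.measurePreserving_swap (μ := soloCoinLaw) (ν := μ)).prod
        (MeasurePreserving.id soloCoinLaw)).comp
        (MeasurePreserving.symm MeasurableEquiv.prodAssoc
          (measurePreserving_prodAssoc soloCoinLaw μ soloCoinLaw)))
  have hG := hmp.comp hsw
  rw [← hG.map_eq, integral_map hG.measurable.aemeasurable hF.aestronglyMeasurable]
  have hint : Integrable (fun z : SoloCoins × I × SoloCoins => F (z.2.1, mixCoins z.1 z.2.2))
      (soloCoinLaw.prod (μ.prod soloCoinLaw)) :=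
    integrable_of_abs_le (hF.comp hG.measurable) fun _ => hFb _
  refine (integral_prod _ hint).trans_le ?_
  refine integral_nonpos fun v' => ?_
  simp only [F, rightPulls_mixCoins p q]
  exact integral_rightPulls_nonpos_of_alwaysLeftOptimal hβ0 hβ1 hq h _

/-! ### The first pull of the right arm -/

/-- The indicator that the arm `a` is right and that no earlier arm is. -/
def firstInd (a : Arm) (l : List Arm) : ℝ := if a = Arm.R ∧ Arm.R ∉ l then 1 else 0

theorem firstInd_nonneg (a : Arm) (l : List Arm) : 0 ≤ firstInd a l := by
  unfold firstInd; split_ifs <;> norm_num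

theorem abs_firstInd_le (a : Arm) (l : List Arm) : |firstInd a l| ≤ 1 := by
  unfold firstInd; split_ifs <;> norm_num

/-- The arms that the single player pulled before round `t`. -/
def soloArms (p : ℝ) (S : SoloStrategy) (θ : I) (v : SoloCoins) (t : ℕ) : List Arm :=
  (soloHistory p S θ v t).map Prod.fst

theorem soloArms_succ (p : ℝ) (S : SoloStrategy) (θ : I) (v : SoloCoins) (t : ℕ) :
    soloArms p S θ v (t + 1) = soloArm p S θ v t :: soloArms p S θ v t := rfl

theorem measurable_soloArms (p : ℝ) (t : ℕ) :
    Measurable fun x : SoloStrategy × I × SoloCoins => soloArms p x.1 x.2.1 x.2.2 t :=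
  (measurable_from_top (f := fun l : List (Arm × Bool) => l.map Prod.fst)).comp
    (measurable_soloHistory p t)

/-- The discount factor of the round in which the right arm is pulled first. -/
def firstPull (β p : ℝ) (S : SoloStrategy) (θ : I) (v : SoloCoins) : ℝ :=
  discount β fun t => firstInd (soloArm p S θ v t) (soloArms p S θ v t)

theorem measurable_firstInd_solo (p : ℝ) (t : ℕ) :
    Measurable fun x : SoloStrategy × I × SoloCoins =>
      firstInd (soloArm p x.1 x.2.1 x.2.2 t) (soloArms p x.1 x.2.1 x.2.2 t) :=
  measurable_comp_countable (f := fun l (x : SoloStrategy × I × SoloCoins) =>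
    firstInd (soloArm p x.1 x.2.1 x.2.2 t) l)
    (fun l => (measurable_from_top (f := fun a => firstInd a l)).comp (measurable_soloArm p t))
    (measurable_soloArms p t)

theorem measurable_firstPull (hβ0 : 0 < β) (hβ1 : β < 1) (p : ℝ) :
    Measurable fun x : SoloStrategy × I × SoloCoins => firstPull β p x.1 x.2.1 x.2.2 :=
  measurable_discount hβ0 hβ1 (measurable_firstInd_solo p) fun _ _ => abs_firstInd_le _ _

theorem abs_firstPull_le (hβ0 : 0 < β) (hβ1 : β < 1) (p : ℝ) (S : SoloStrategy) (θ : I)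
    (v : SoloCoins) : |firstPull β p S θ v| ≤ 1 * (1 - β)⁻¹ :=
  abs_discount_le hβ0 hβ1 fun _ => abs_firstInd_le _ _

theorem firstPull_nonneg (hβ0 : 0 < β) (p : ℝ) (S : SoloStrategy) (θ : I)
    (v : SoloCoins) : 0 ≤ firstPull β p S θ v :=
  tsum_nonneg fun t => mul_nonneg (firstInd_nonneg _ _) (pow_pos hβ0 t).le

/-- From the first pull in round τ on, at most every round is a pull of `R`, so the discounted count
is at most β^τ/(1 - β). -/
theorem mul_rightPulls_le_firstPull (hβ0 : 0 < β) (hβ1 : β < 1) (p : ℝ) (S : SoloStrategy) (θ : I)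
    (v : SoloCoins) : (1 - β) * rightPulls β p S θ v ≤ firstPull β p S θ v := by
  -- The index `t + 1` makes `d t` count round `t` itself. Thus `firstInd` is the increment of `d`,
  -- summation by parts gives the factor 1 - β, and `d` dominates the indicator of a right pull.
  set d : ℕ → ℝ := fun t => if Arm.R ∈ soloArms p S θ v (t + 1) then 1 else 0 with hd
  have hdb : ∀ t, |d t| ≤ 1 := fun t => by simp only [hd]; split_ifs <;> norm_num
  have h0 : firstInd (soloArm p S θ v 0) (soloArms p S θ v 0) = d 0 := by
    have : soloArms p S θ v 0 = [] := rfl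
    simp [hd, firstInd, soloArms_succ, this, eq_comm]
  have h1 : ∀ t, firstInd (soloArm p S θ v (t + 1)) (soloArms p S θ v (t + 1))
      = 1 * d (t + 1) + (-1) * d t := fun t => by
    simp only [hd, firstInd, soloArms_succ p S θ v (t + 1), List.mem_cons]
    by_cases ha : soloArm p S θ v (t + 1) = Arm.R <;>
      by_cases hl : Arm.R ∈ soloArms p S θ v (t + 1) <;>
        simp [ha, hl, eq_comm (a := Arm.R)]
  have h2 : firstPull β p S θ v = (1 - β) * discount β d := by
    unfold firstPull
    rw [discount_succ hβ0 hβ1 fun t => abs_firstInd_le _ _, h0]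
    simp only [h1]
    rw [discount_add_mul hβ0 hβ1 (fun t => hdb (t + 1)) hdb]
    have := discount_succ hβ0 hβ1 hdb
    linear_combination (-1 : ℝ) * this
  rw [h2]
  refine mul_le_mul_of_nonneg_left ?_ (by linarith)
  refine discount_mono hβ0 hβ1 (fun t => abs_rightInd_le _) hdb fun t => ?_
  simp only [hd, rightInd, soloArms_succ, List.mem_cons]
  by_cases ha : soloArm p S θ v t = Arm.R
  · simp [ha]
  · simp only [ha, if_false]; split_ifs <;> norm_num

/-- Until `R` is pulled, every reward compares a coin with `p`, so θ has not entered. -/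
theorem soloHistory_eq_of_not_mem (p : ℝ) (S : SoloStrategy) {θ : I} (θ' : I) {v : SoloCoins}
    {t : ℕ} (h : Arm.R ∉ soloArms p S θ v t) :
    soloHistory p S θ v t = soloHistory p S θ' v t := by
  induction t with
  | zero => rfl
  | succ t ih =>
    rw [soloArms_succ, List.mem_cons, not_or] at h
    have h1 := ih h.2
    have ha : soloArm p S θ v t = Arm.L := by
      cases h3 : soloArm p S θ v t
      · rfl
      · exact absurd h3.symm h.1
    have hb : soloArm p S θ' v t = Arm.L := by rw [← ha]; simp only [soloArm, h1]
    simp only [soloHistory_succ, ha, hb, h1, successProb]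

theorem firstInd_solo_congr (p : ℝ) (S : SoloStrategy) (θ θ' : I) (v : SoloCoins) (t : ℕ) :
    firstInd (soloArm p S θ v t) (soloArms p S θ v t)
      = firstInd (soloArm p S θ' v t) (soloArms p S θ' v t) := by
  by_cases h : Arm.R ∈ soloArms p S θ v t
  · by_cases h' : Arm.R ∈ soloArms p S θ' v t
    · simp [firstInd, h, h']
    · have := soloHistory_eq_of_not_mem p S θ h'
      simp only [soloArms, soloArm, this]
  · have := soloHistory_eq_of_not_mem p S θ' h
    simp only [soloArms, soloArm, this]

theorem firstPull_congr (p : ℝ) (S : SoloStrategy) (θ θ' : I) (v : SoloCoins) :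
    firstPull β p S θ v = firstPull β p S θ' v := by
  unfold firstPull
  simp only [firstInd_solo_congr p S θ θ']

/-- The time of the first pull is a function of the coins alone, hence independent of θ, and the
integral over the product measure factors. -/
theorem integral_mul_firstPull (p : ℝ) (S : SoloStrategy) :
    ∫ z, ((z.1 : ℝ) - p) * firstPull β p S z.1 z.2 ∂(μ.prod soloCoinLaw)
      = (priorMean μ - p) * ∫ z, firstPull β p S z.1 z.2 ∂(μ.prod soloCoinLaw) := by
  have h : ∀ z : I × SoloCoins, firstPull β p S z.1 z.2 = firstPull β p S 0 z.2 :=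
    fun z => firstPull_congr p S _ _ _
  have hI : Integrable (fun θ : I => (θ : ℝ)) μ :=
    integrable_of_abs_le (C := 1) (by fun_prop) fun θ => by
      rw [abs_of_nonneg θ.2.1]; exact θ.2.2
  simp only [h]
  rw [integral_prod_mul (fun θ : I => (θ : ℝ) - p) (fun v => firstPull β p S 0 v),
    integral_fun_snd (fun v => firstPull β p S 0 v), integral_sub hI (integrable_const _)]
  simp [priorMean]

/-! ### Copying with a delay -/

/-- The answer to the past arms of the other player, most recent first: pull the right arm if the
other player just pulled it, but not for the first time. -/
def copyArm : List Arm → Arm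
  | [] => Arm.L
  | a :: l => if a = Arm.R ∧ Arm.R ∈ l then Arm.R else Arm.L

theorem rightInd_copyArm_cons (a : Arm) (l : List Arm) :
    rightInd (copyArm (a :: l)) = 1 * rightInd a + (-1) * firstInd a l := by
  by_cases ha : a = Arm.R <;> by_cases hl : Arm.R ∈ l <;>
    simp [copyArm, rightInd, firstInd, ha, hl]

/-- The copier's pulls are the opponent's pulls minus the first one, shifted by one round; the shift
costs a factor β. -/
theorem discount_copyArm (hβ0 : 0 < β) (hβ1 : β < 1) (p : ℝ) (S : SoloStrategy) (θ : I)
    (v : SoloCoins) : discount β (fun t => rightInd (copyArm (soloArms p S θ v t)))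
      = β * (rightPulls β p S θ v - firstPull β p S θ v) := by
  rw [discount_succ hβ0 hβ1 fun t => abs_rightInd_le _]
  simp only [soloArms_succ, rightInd_copyArm_cons]
  rw [discount_add_mul hβ0 hβ1 (fun t => abs_rightInd_le _) (fun t => abs_firstInd_le _ _)]
  have : rightInd (copyArm (soloArms p S θ v 0)) = 0 := by simp [soloArms, soloHistory, copyArm,
    rightInd]
  rw [this, rightPulls, firstPull]
  ring

/-- The expected discounted advantage, given the success probability of the right arm, over an
opponent who copies with a delay. -/
def advantage (β p : ℝ) (S : SoloStrategy) (θ : I) (v : SoloCoins) : ℝ :=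
  (θ - p) * (rightPulls β p S θ v
    - discount β fun t => rightInd (copyArm (soloArms p S θ v t)))

theorem integrable_sub_mul {X : Type*} [MeasurableSpace X] {P : Measure X} [IsFiniteMeasure P]
    {p C : ℝ} (hp : p ∈ Icc (0 : ℝ) 1) {θ : X → I} {F : X → ℝ} (hθ : Measurable θ)
    (hF : Measurable F) (hC : ∀ x, |F x| ≤ C) : Integrable (fun x => ((θ x : ℝ) - p) * F x) P := by
  refine integrable_of_abs_le (C := 1 * C) (by fun_prop) fun x => ?_
  rw [abs_mul]
  exact mul_le_mul (abs_sub_le_one hp _) (hC x) (abs_nonneg _) zero_le_one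

theorem integrable_advantage {X : Type*} [MeasurableSpace X] {P : Measure X} [IsFiniteMeasure P]
    (hβ0 : 0 < β) (hβ1 : β < 1) {p : ℝ} (hp : p ∈ Icc (0 : ℝ) 1)
    {x : X → SoloStrategy × I × SoloCoins} (hx : Measurable x) :
    Integrable (fun y => advantage β p (x y).1 (x y).2.1 (x y).2.2) P := by
  unfold advantage
  have hm : Measurable fun x : SoloStrategy × I × SoloCoins => rightPulls β p x.1 x.2.1 x.2.2
      - discount β fun t => rightInd (copyArm (soloArms p x.1 x.2.1 x.2.2 t)) := by
    simp only [discount_copyArm hβ0 hβ1]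
    have h1 := measurable_rightPulls hβ0 hβ1 p
    have h2 := measurable_firstPull hβ0 hβ1 p
    fun_prop
  refine integrable_sub_mul (C := 1 * (1 - β)⁻¹ + 1 * (1 - β)⁻¹) (θ := fun y => (x y).2.1) hp
    (by fun_prop) (hm.comp hx) fun y => ?_
  refine (abs_sub _ _).trans (add_le_add (abs_rightPulls_le hβ0 hβ1 _ _ _ _)
    (abs_discount_le hβ0 hβ1 fun t => abs_rightInd_le _))

theorem integral_advantage_le (hβ0 : 0 < β) (hβ1 : β < 1) {p q : ℝ} (hp : p ∈ Icc (0 : ℝ) 1)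
    (hq : q ∈ Icc (0 : ℝ) 1) (h : AlwaysLeftOptimal μ β q) (S : SoloStrategy) :
    ∫ z, advantage β p S z.1 z.2 ∂(μ.prod soloCoinLaw)
      ≤ (max (q - p) 0 - β * (p - priorMean μ)) *
        ∫ z, firstPull β p S z.1 z.2 ∂(μ.prod soloCoinLaw) := by
  have hW := measurable_solo_pair (measurable_rightPulls hβ0 hβ1 p) S
  have hE := measurable_solo_pair (measurable_firstPull hβ0 hβ1 p) S
  have iE : Integrable (fun z : I × SoloCoins => firstPull β p S z.1 z.2) (μ.prod soloCoinLaw) :=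
    integrable_of_abs_le hE fun z => abs_firstPull_le hβ0 hβ1 _ _ _ _
  have iW := integrable_sub_mul (P := μ.prod soloCoinLaw) (θ := Prod.fst) hq measurable_fst hW
    fun z => abs_rightPulls_le hβ0 hβ1 _ _ _ _
  have iT := integrable_sub_mul (P := μ.prod soloCoinLaw) (θ := Prod.fst) hp measurable_fst hE
    fun z => abs_firstPull_le hβ0 hβ1 _ _ _ _
  have i1 := iW.const_mul (1 - β)
  have i2 := iE.const_mul (max (q - p) 0)
  have i3 := iT.const_mul β
  -- Write θ - p = (θ - q) + (q - p) in the term (1 - β)(θ - p)W. The part with q - p is bounded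
  -- through 0 ≤ (1 - β)W ≤ E; the maximum with 0 covers q < p, where that part is simply dropped.
  calc ∫ z, advantage β p S z.1 z.2 ∂(μ.prod soloCoinLaw)
      ≤ ∫ z, ((1 - β) * (((z.1 : ℝ) - q) * rightPulls β p S z.1 z.2)
          + max (q - p) 0 * firstPull β p S z.1 z.2
          + β * (((z.1 : ℝ) - p) * firstPull β p S z.1 z.2)) ∂(μ.prod soloCoinLaw) := by
        refine integral_mono
          (integrable_advantage hβ0 hβ1 hp 
            (x := fun z : I × SoloCoins => (S, z.1, z.2)) (by fun_prop))
          ((i1.add i2).add i3) fun z => ?_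
        simp only [advantage, discount_copyArm hβ0 hβ1]
        have h1 := mul_rightPulls_le_firstPull hβ0 hβ1 p S z.1 z.2
        have h0 : 0 ≤ (1 - β) * rightPulls β p S z.1 z.2 :=
          mul_nonneg (by linarith) (tsum_nonneg fun t => mul_nonneg (rightInd_nonneg _)
            (pow_pos hβ0 t).le)
        have h2 : (q - p) * ((1 - β) * rightPulls β p S z.1 z.2)
            ≤ max (q - p) 0 * firstPull β p S z.1 z.2 :=
          (mul_le_mul_of_nonneg_right (le_max_left _ 0) h0).trans
            (mul_le_mul_of_nonneg_left h1 (le_max_right _ _))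
        linarith
    _ = (1 - β) * ∫ z, ((z.1 : ℝ) - q) * rightPulls β p S z.1 z.2 ∂(μ.prod soloCoinLaw)
          + max (q - p) 0 * ∫ z, firstPull β p S z.1 z.2 ∂(μ.prod soloCoinLaw)
          + β * ((priorMean μ - p) * ∫ z, firstPull β p S z.1 z.2 ∂(μ.prod soloCoinLaw)) := by
        have e1 := integral_add (i1.add i2) i3
        have e2 := integral_add i1 i2
        simp only [Pi.add_apply] at e1 e2
        rw [e1, e2, integral_const_mul, integral_const_mul, integral_const_mul,
          integral_mul_firstPull]
    _ ≤ _ := by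
        have := mul_nonpos_of_nonneg_of_nonpos (by linarith : 0 ≤ 1 - β)
          (integral_rightPulls_nonpos (p := p) hβ0 hβ1 hq h S)
        linarith

/-! ### The Gittins index -/

/-- No strategy earns more than 1/(1 - β). This makes the set behind the Gittins index non-empty, so
that its infimum is not a default value. -/
theorem alwaysLeftOptimal_one (hβ0 : 0 < β) (hβ1 : β < 1) : AlwaysLeftOptimal μ β 1 := by
  intro τ
  have hp : (1 : ℝ) ∈ Icc (0 : ℝ) 1 := by simp
  rw [soloValue_dirac hβ0 hβ1 hp]
  have h0 : ∀ z : I × SoloCoins, rightPulls β 1 alwaysLeft z.1 z.2 = 0 := fun z => by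
    simp [rightPulls, soloArm, alwaysLeft, rightInd, discount]
  simp only [h0, mul_zero, integral_zero, add_zero]
  refine (le_abs_self _).trans ?_
  rw [← Real.norm_eq_abs]
  refine (norm_integral_le_of_norm_le_const (C := 1 * (1 - β)⁻¹) (ae_of_all _ fun ω => ?_)).trans ?_
  · exact abs_discount_le hβ0 hβ1 fun t => abs_soloReward_le _ _ _ _ t
  · simp

/-- Pull the right arm once, and go on with it if and only if this gave a reward. -/
def exploreThenCommit : SoloStrategy := fun h =>
  match h.getLast? with
  | none => Arm.R
  | some x => if x.2 then Arm.R else Arm.L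

/-- The last entry of a history is its oldest one, that is, round 0. -/
theorem getLast_exploreThenCommit (q : ℝ) (θ : I) (v : SoloCoins) (t : ℕ) :
    (soloHistory q exploreThenCommit θ v (t + 1)).getLast? = some (Arm.R, ltBit (v 0 Arm.R) θ) := by
  induction t with
  | zero => rfl
  | succ t ih =>
    rw [soloHistory_succ, soloHistory_succ] at *
    rw [List.getLast?_cons_cons]
    exact ih

theorem rightPulls_exploreThenCommit (hβ0 : 0 < β) (hβ1 : β < 1) (q : ℝ) (θ : I) (v : SoloCoins) :
    rightPulls β q exploreThenCommit θ v
      = 1 + β * (1 - β)⁻¹ * soloReward q exploreThenCommit θ v 0 := by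
  have h1 : ∀ t, rightInd (soloArm q exploreThenCommit θ v (t + 1))
      = soloReward q exploreThenCommit θ v 0 := fun t => by
    have h2 : soloReward q exploreThenCommit θ v 0 = bitValue (ltBit (v 0 Arm.R) θ) := rfl
    have h3 : soloArm q exploreThenCommit θ v (t + 1)
        = if ltBit (v 0 Arm.R) θ then Arm.R else Arm.L := by
      simp only [soloArm, exploreThenCommit]
      rw [getLast_exploreThenCommit]
    rw [h2, h3]
    cases ltBit (v 0 Arm.R) θ <;> simp [rightInd, bitValue]
  rw [rightPulls, discount_succ hβ0 hβ1 fun t => abs_rightInd_le _]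
  simp only [h1]
  rw [discount_const hβ0 hβ1]
  have : rightInd (soloArm q exploreThenCommit θ v 0) = 1 := by
    simp [soloArm, soloHistory, exploreThenCommit, rightInd]
  rw [this]
  ring

theorem integrable_coe : Integrable (fun θ : I => (θ : ℝ)) μ :=
  integrable_of_abs_le (C := 1) (by fun_prop) fun θ => by
    rw [abs_of_nonneg θ.2.1]; exact θ.2.2

theorem integrable_coe_sq : Integrable (fun θ : I => (θ : ℝ) ^ 2) μ :=
  integrable_of_abs_le (C := 1) (by fun_prop) fun θ => by
    rw [abs_of_nonneg (sq_nonneg _)]; exact pow_le_one₀ θ.2.1 θ.2.2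

theorem integral_quadratic (a b c : ℝ) :
    ∫ θ : I, (a * (θ : ℝ) + b * (θ : ℝ) ^ 2 + c) ∂μ
      = a * priorMean μ + b * (∫ θ, (θ : ℝ) ^ 2 ∂μ) + c := by
  have i1 := (integrable_coe (μ := μ)).const_mul a
  have i2 := (integrable_coe_sq (μ := μ)).const_mul b
  have e1 := integral_add (i1.add i2) (integrable_const c)
  have e2 := integral_add i1 i2
  simp only [Pi.add_apply] at e1 e2
  rw [e1, e2, integral_const_mul, integral_const_mul]
  simp [priorMean]

/-- Given θ, trying `R` once and keeping it after a success makes 1 + β(1 - β)⁻¹θ expected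
discounted pulls of `R`. The left side is the mean of θ - q times this number, the gain over always
pulling `L`. -/
theorem explore_nonpos (hβ0 : 0 < β) (hβ1 : β < 1) {q : ℝ}
    (hq : q ∈ Icc (0 : ℝ) 1) (h : AlwaysLeftOptimal μ β q) :
    priorMean μ - q + β * (1 - β)⁻¹ * ((∫ θ, (θ : ℝ) ^ 2 ∂μ) - q * priorMean μ) ≤ 0 := by
  have h1 := integral_rightPulls_nonpos_of_alwaysLeftOptimal hβ0 hβ1 hq h exploreThenCommit
  have hint := integrable_sub_mul (P := μ.prod soloCoinLaw) (θ := Prod.fst) hq measurable_fst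
    (measurable_solo_pair (measurable_rightPulls hβ0 hβ1 q) exploreThenCommit)
    fun z => abs_rightPulls_le hβ0 hβ1 _ _ _ _
  rw [integral_prod _ hint] at h1
  have h2 : ∀ θ : I, ∫ v, ((θ : ℝ) - q) * rightPulls β q exploreThenCommit θ v ∂soloCoinLaw
      = (1 - β * (1 - β)⁻¹ * q) * θ + β * (1 - β)⁻¹ * (θ : ℝ) ^ 2 + -q := fun θ => by
    have hr : Integrable (fun v => soloReward q exploreThenCommit θ v 0) soloCoinLaw :=
      integrable_of_abs_le ((measurable_soloReward q 0).comp
        (f := fun v => (exploreThenCommit, θ, v)) (by fun_prop))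
        fun v => abs_soloReward_le _ _ _ _ _
    simp only [rightPulls_exploreThenCommit hβ0 hβ1]
    rw [integral_const_mul, integral_add (integrable_const _) (hr.const_mul _), integral_const_mul,
      integral_soloReward hq]
    have h3 : ∀ v, successProb q θ (soloArm q exploreThenCommit θ v 0) = θ := fun v => rfl
    simp only [h3, integral_const, probReal_univ, smul_eq_mul, one_mul]
    ring
  simp only [h2] at h1
  rw [integral_quadratic] at h1
  linarith

theorem priorMean_mem : priorMean μ ∈ Icc (0 : ℝ) 1 := by
  refine ⟨integral_nonneg fun θ => θ.2.1, ?_⟩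
  have := integral_mono (integrable_coe (μ := μ)) (integrable_const (1 : ℝ)) fun θ => θ.2.2
  simpa [priorMean] using this

/-- The difference is the variance of the prior; if it vanished, θ would be almost surely its mean
and the prior a point mass. -/
theorem sq_priorMean_lt (hμ : ∀ x : I, μ ≠ Measure.dirac x) :
    priorMean μ ^ 2 < ∫ θ, (θ : ℝ) ^ 2 ∂μ := by
  set m := priorMean μ with hm
  have hsq : ∫ θ : I, ((θ : ℝ) - m) ^ 2 ∂μ = (∫ θ, (θ : ℝ) ^ 2 ∂μ) - m ^ 2 := by
    have : ∀ θ : I, ((θ : ℝ) - m) ^ 2 = (-2 * m) * (θ : ℝ) + 1 * (θ : ℝ) ^ 2 + m ^ 2 :=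
      fun θ => by ring
    simp only [this]
    rw [integral_quadratic, ← hm]
    ring
  have hint : Integrable (fun θ : I => ((θ : ℝ) - m) ^ 2) μ := by
    refine integrable_of_abs_le (C := 1) (by fun_prop) fun θ => ?_
    rw [abs_pow]
    exact pow_le_one₀ (abs_nonneg _) (abs_sub_le_one priorMean_mem θ)
  have h0 : 0 ≤ ∫ θ : I, ((θ : ℝ) - m) ^ 2 ∂μ := integral_nonneg fun θ => sq_nonneg _
  rcases h0.lt_or_eq with h | h
  · linarith
  · exfalso
    have hae := (integral_eq_zero_iff_of_nonneg (fun θ : I => sq_nonneg ((θ : ℝ) - m)) hint).1 h.symm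
    have hae' : (fun θ : I => θ) =ᵐ[μ] fun _ => (⟨m, priorMean_mem⟩ : I) := by
      filter_upwards [hae] with θ hθ
      have : (θ : ℝ) - m = 0 := by simpa using hθ
      exact Subtype.ext (by linarith)
    refine hμ ⟨m, priorMean_mem⟩ ?_
    have hmap : μ.map (fun θ : I => θ) = μ.map fun _ => (⟨m, priorMean_mem⟩ : I) :=
      Measure.map_congr hae'
    rw [Measure.map_id', Measure.map_const] at hmap
    simpa using hmap

/-- With k = β/(1 - β) and M the second moment, `explore_nonpos` says q ≥ (m + kM)/(1 + km) for
every q in the set behind the index. This bound exceeds m because M > m². -/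
theorem priorMean_lt_gittinsIndex (hμ : ∀ x : I, μ ≠ Measure.dirac x) (hβ0 : 0 < β)
    (hβ1 : β < 1) : priorMean μ < gittinsIndex μ β := by
  set m := priorMean μ with hm
  set k := β * (1 - β)⁻¹ with hk
  have hk0 : 0 < k := mul_pos hβ0 (inv_pos.2 (by linarith))
  have hm0 : 0 ≤ m := priorMean_mem.1
  have hd : 0 < 1 + k * m := by positivity
  have hM := sq_priorMean_lt hμ
  set M := ∫ θ, (θ : ℝ) ^ 2 ∂μ
  have h1 : m < (m + k * M) / (1 + k * m) := by
    rw [lt_div_iff₀ hd]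
    nlinarith
  refine h1.trans_le (le_csInf ⟨1, by simp, alwaysLeftOptimal_one hβ0 hβ1⟩ ?_)
  rintro q ⟨hq, hopt⟩
  have := explore_nonpos hβ0 hβ1 hq hopt
  rw [div_le_iff₀ hd]
  linarith

/-- Choosing q just above the index avoids proving that the infimum is attained or that optimality
of `L` is monotone in the success probability of the left arm. -/
theorem exists_alwaysLeftOptimal_lt (hβ0 : 0 < β) (hβ1 : β < 1) {x : ℝ}
    (hx : gittinsIndex μ β < x) : ∃ q ∈ Icc (0 : ℝ) 1, q < x ∧ AlwaysLeftOptimal μ β q := by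
  obtain ⟨q, hq, hlt⟩ := exists_lt_of_csInf_lt
    (s := {p : ℝ | p ∈ Icc (0 : ℝ) 1 ∧ AlwaysLeftOptimal μ β p})
    ⟨1, by simp, alwaysLeftOptimal_one hβ0 hβ1⟩ hx
  exact ⟨q, hq.1, hlt, hq.2⟩

instance : MeasurableSpace Player := ⊤

/-! ### The game -/

theorem measurable_drawBit (D : DrawModel) (p : ℝ) (i : Player) (t : ℕ) (a : Arm) :
    Measurable fun ω : Sample => drawBit D p ω.2.2.1 ω.2.2.2 i t a :=
  measurable_decide_lt (by fun_prop) ((measurable_successProb p a).comp (by fun_prop))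

theorem measurable_histories (D : DrawModel) (p : ℝ) (t : ℕ) :
    Measurable fun ω : Sample => histories D p ω t := by
  induction t with
  | zero => exact measurable_const
  | succ t ih =>
    let f (h : List Obs × List Obs) (c : Arm × Arm) (d : Bool × Bool) : List Obs × List Obs :=
      ((c.1, c.2, d.1) :: h.1, (c.2, c.1, d.2) :: h.2)
    refine measurable_comp_countable
      (f := fun (h : List Obs × List Obs) (ω : Sample) => f h (ω.1 h.1, ω.2.1 h.2)
        (drawBit D p ω.2.2.1 ω.2.2.2 Player.alice t (ω.1 h.1),
          drawBit D p ω.2.2.1 ω.2.2.2 Player.bob t (ω.2.1 h.2))) (fun h => ?_) ih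
    refine measurable_comp_countable
      (f := fun (c : Arm × Arm) (ω : Sample) => f h c
        (drawBit D p ω.2.2.1 ω.2.2.2 Player.alice t c.1,
          drawBit D p ω.2.2.1 ω.2.2.2 Player.bob t c.2)) (fun c => ?_)
      (g := fun ω : Sample => (ω.1 h.1, ω.2.1 h.2)) (by fun_prop)
    exact (measurable_of_countable (f h c)).comp
      ((measurable_drawBit D p _ t _).prodMk (measurable_drawBit D p _ t _))

theorem measurable_armPulled (D : DrawModel) (p : ℝ) (t : ℕ) (i : Player) :
    Measurable fun ω : Sample => armPulled D p ω t i := by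
  cases i
  · exact measurable_comp_countable (f := fun (h : List Obs × List Obs) (ω : Sample) => ω.1 h.1)
      (fun h => by fun_prop) (measurable_histories D p t)
  · exact measurable_comp_countable (f := fun (h : List Obs × List Obs) (ω : Sample) => ω.2.1 h.2)
      (fun h => by fun_prop) (measurable_histories D p t)

theorem measurable_reward (D : DrawModel) (p : ℝ) (i : Player) (t : ℕ) :
    Measurable fun ω : Sample => reward D p ω i t :=
  measurable_comp_countable
    (f := fun a (ω : Sample) => bitValue (drawBit D p ω.2.2.1 ω.2.2.2 i t a))
    (fun a => measurable_bitValue.comp (measurable_drawBit D p i t a))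
    (measurable_armPulled D p t i)

theorem measurable_successProb_armPulled (D : DrawModel) (p : ℝ) (i : Player) (t : ℕ) :
    Measurable fun ω : Sample => successProb p ω.2.2.1 (armPulled D p ω t i) :=
  measurable_comp_countable (f := fun a (ω : Sample) => successProb p ω.2.2.1 a)
    (fun a => (measurable_successProb p a).comp (by fun_prop)) (measurable_armPulled D p t i)

theorem histories_congr (D : DrawModel) (p : ℝ) (SA SB : PureStrategy) (θ : I) {u u' : Coins}
    {t : ℕ} (h : ∀ s < t, u s = u' s) :
    histories D p (SA, SB, θ, u) t = histories D p (SA, SB, θ, u') t := by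
  induction t with
  | zero => rfl
  | succ t ih =>
    have h1 := ih fun s hs => h s (hs.trans t.lt_succ_self)
    have h2 : ∀ i a, drawBit D p θ u i t a = drawBit D p θ u' i t a := fun i a => by
      simp only [drawBit, h t t.lt_succ_self]
    simp only [histories, h1, h2]

instance (σA σB : MixedStrategy) : IsProbabilityMeasure (gameLaw μ σA σB) := by
  unfold gameLaw; infer_instance

theorem integral_gameLaw (σA σB : MixedStrategy) {F : Sample → ℝ} {C : ℝ} (hF : Measurable F)
    (hC : ∀ ω, |F ω| ≤ C) : ∫ ω, F ω ∂gameLaw μ σA σB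
      = ∫ SA, ∫ SB, ∫ θ, ∫ u, F (SA, SB, θ, u) ∂coinLaw ∂μ ∂(σB : Measure PureStrategy)
        ∂(σA : Measure PureStrategy) := by
  unfold gameLaw
  rw [integral_prod _ (integrable_of_abs_le hF hC)]
  refine integral_congr_ae (ae_of_all _ fun SA => ?_)
  simp only
  have h1 : Integrable (fun z : PureStrategy × I × Coins => F (SA, z))
      ((σB : Measure PureStrategy).prod (μ.prod coinLaw)) :=
    integrable_of_abs_le (hF.comp measurable_prodMk_left) fun _ => hC _
  rw [integral_prod _ h1]
  refine integral_congr_ae (ae_of_all _ fun SB => ?_)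
  have h2 : Integrable (fun z : I × Coins => F (SA, SB, z)) (μ.prod coinLaw) :=
    integrable_of_abs_le ((hF.comp measurable_prodMk_left).comp measurable_prodMk_left)
      fun _ => hC _
  exact integral_prod _ h2

/-- Arms of round `t` are fixed by earlier coins. The argument concerns one player at a time, so a
draw common to both players does no harm. -/
theorem integral_reward (D : DrawModel) {p : ℝ} (hp : p ∈ Icc (0 : ℝ) 1) (σA σB : MixedStrategy)
    (i : Player) (t : ℕ) : ∫ ω, reward D p ω i t ∂gameLaw μ σA σB
      = ∫ ω, successProb p ω.2.2.1 (armPulled D p ω t i) ∂gameLaw μ σA σB := by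
  rw [integral_gameLaw (C := 1) σA σB (measurable_reward D p i t) fun ω => abs_bitValue_le _,
    integral_gameLaw (C := 1) σA σB (measurable_successProb_armPulled D p i t)
      fun ω => abs_successProb_le hp _ _]
  have key : ∀ SA SB θ, ∫ u, reward D p (SA, SB, θ, u) i t ∂coinLaw
      = ∫ u, successProb p θ (armPulled D p (SA, SB, θ, u) t i) ∂coinLaw := fun SA SB θ => by
    refine integral_bitValue_of_adapted (J := Arm × Player) (c := fun j => successProb p θ j.1)
      (fun j => successProb_mem hp θ _) t
      (a := fun u => (armPulled D p (SA, SB, θ, u) t i, D.source i)) ?_ fun u y => ?_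
    · exact ((measurable_armPulled D p t i).comp (f := fun u => (SA, SB, θ, u))
        (by fun_prop)).prodMk measurable_const
    · have := histories_congr D p SA SB θ (u := Function.update u t y) (u' := u) (t := t)
        fun s hs => Function.update_of_ne hs.ne _ _
      cases i <;> simp only [armPulled, this]
  simp only [key]

/-- The discounted sum of the success probabilities of the arms that player `i` pulls. -/
def expectedTotal (D : DrawModel) (β p : ℝ) (ω : Sample) (i : Player) : ℝ :=
  discount β fun t => successProb p ω.2.2.1 (armPulled D p ω t i)

theorem integrable_totalReward (hβ0 : 0 < β) (hβ1 : β < 1) (D : DrawModel) (p : ℝ)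
    (σA σB : MixedStrategy) (i : Player) :
    Integrable (fun ω => totalReward D β p ω i) (gameLaw μ σA σB) :=
  integrable_discount hβ0 hβ1 (measurable_reward D p i) fun _ _ => abs_bitValue_le _

theorem integrable_expectedTotal (hβ0 : 0 < β) (hβ1 : β < 1) (D : DrawModel) {p : ℝ}
    (hp : p ∈ Icc (0 : ℝ) 1) (σA σB : MixedStrategy) (i : Player) :
    Integrable (fun ω => expectedTotal D β p ω i) (gameLaw μ σA σB) :=
  integrable_discount hβ0 hβ1 (measurable_successProb_armPulled D p i)
    fun _ _ => abs_successProb_le hp _ _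

theorem integral_totalReward (hβ0 : 0 < β) (hβ1 : β < 1) (D : DrawModel) {p : ℝ}
    (hp : p ∈ Icc (0 : ℝ) 1) (σA σB : MixedStrategy) (i : Player) :
    ∫ ω, totalReward D β p ω i ∂gameLaw μ σA σB
      = ∫ ω, expectedTotal D β p ω i ∂gameLaw μ σA σB := by
  have h1 := integral_discount (P := gameLaw μ σA σB) hβ0 hβ1 (measurable_reward D p i)
    fun _ _ => abs_bitValue_le _
  have h2 := integral_discount (P := gameLaw μ σA σB) hβ0 hβ1
    (measurable_successProb_armPulled D p i) fun _ _ => abs_successProb_le hp _ _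
  simp only [← integral_reward D hp] at h2
  exact h1.trans h2.symm

theorem utilityA_neg_one (hβ0 : 0 < β) (hβ1 : β < 1) (D : DrawModel) {p : ℝ}
    (hp : p ∈ Icc (0 : ℝ) 1) (σA σB : MixedStrategy) :
    utilityA D μ β (-1) p σA σB = ∫ ω, (expectedTotal D β p ω Player.alice
      - expectedTotal D β p ω Player.bob) ∂gameLaw μ σA σB := by
  unfold utilityA
  simp only [neg_one_mul, ← sub_eq_add_neg]
  rw [integral_sub (integrable_totalReward hβ0 hβ1 D p _ _ _)
      (integrable_totalReward hβ0 hβ1 D p _ _ _),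
    integral_sub (integrable_expectedTotal hβ0 hβ1 D hp _ _ _)
      (integrable_expectedTotal hβ0 hβ1 D hp _ _ _),
    integral_totalReward hβ0 hβ1 D hp, integral_totalReward hβ0 hβ1 D hp]

theorem utilityB_neg_one {μ : Measure I} (D : DrawModel) (p : ℝ) (σA σB : MixedStrategy) :
    utilityB D μ β (-1) p σA σB = -utilityA D μ β (-1) p σA σB := by
  unfold utilityA utilityB
  rw [← integral_neg]
  refine integral_congr_ae (ae_of_all _ fun ω => ?_)
  simp only
  ring

theorem ae_snd_eq_of_dirac (τ : MixedStrategy) (T : PureStrategy) :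
    ∀ᵐ ω ∂gameLaw μ τ (diracProba T), ω.2.1 = T := by
  have h : MeasurePreserving (fun ω : Sample => ω.2.1) (gameLaw μ τ (diracProba T))
      (Measure.dirac T) := measurePreserving_fst.comp measurePreserving_snd
  have := (ae_dirac_iff (a := T) (p := fun x => x = T) (measurableSet_singleton T)).2 rfl
  exact h.quasiMeasurePreserving.ae this

theorem ae_fst_eq_of_dirac (τ : MixedStrategy) (T : PureStrategy) :
    ∀ᵐ ω ∂gameLaw μ (diracProba T) τ, ω.1 = T := by
  have h : MeasurePreserving (fun ω : Sample => ω.1) (gameLaw μ (diracProba T) τ)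
      (Measure.dirac T) := measurePreserving_fst
  have := (ae_dirac_iff (a := T) (p := fun x => x = T) (measurableSet_singleton T)).2 rfl
  exact h.quasiMeasurePreserving.ae this

/-! ### Playing against the copying strategy -/

/-- The pure strategy that copies the other player with a delay. -/
def copyStrategy : PureStrategy := fun h => copyArm (h.map fun o => o.2.1)

/-- The observations, against the copying strategy, that go with a single player's history. -/
def withCopies : List (Arm × Bool) → List Obs
  | [] => []
  | (a, b) :: l => (a, copyArm (l.map Prod.fst), b) :: withCopies l

/-- The single-player strategy that a strategy amounts to against the copying strategy. -/
def againstCopy (S : PureStrategy) : SoloStrategy := fun h => S (withCopies h)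

/-- The points that decide the rewards of player `i`. -/
def playerCoins (D : DrawModel) (i : Player) (u : Coins) : SoloCoins :=
  fun t a => u t (a, D.source i)

/-- In either draw model the coins of a single player are i.i.d. uniform. Only these marginals are
used, never the joint law of both players' coins. -/
theorem measurePreserving_playerCoins (D : DrawModel) (i : Player) :
    MeasurePreserving (playerCoins D i) coinLaw soloCoinLaw :=
  measurePreserving_comp_injective (f := fun a : Arm => (a, D.source i))
    fun _ _ h => congrArg Prod.fst h

theorem measurePreserving_viewA (D : DrawModel) (σA σB : MixedStrategy) :
    MeasurePreserving
      (fun ω : Sample => (ω.1, ω.2.2.1, playerCoins D Player.alice ω.2.2.2))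
      (gameLaw μ σA σB) ((σA : Measure PureStrategy).prod (μ.prod soloCoinLaw)) :=
  (MeasurePreserving.id _).prod
    (((MeasurePreserving.id μ).prod (measurePreserving_playerCoins D Player.alice)).comp
      measurePreserving_snd)

theorem measurePreserving_viewB (D : DrawModel) (σA σB : MixedStrategy) :
    MeasurePreserving
      (fun ω : Sample => (ω.2.1, ω.2.2.1, playerCoins D Player.bob ω.2.2.2))
      (gameLaw μ σA σB) ((σB : Measure PureStrategy).prod (μ.prod soloCoinLaw)) :=
  ((MeasurePreserving.id _).prod
    ((MeasurePreserving.id μ).prod (measurePreserving_playerCoins D Player.bob))).comp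
      measurePreserving_snd

/-- The copier ignores their own rewards, so each of their arms is a function of the opponent's past
arms. The opponent can compute what the copier does, and the game becomes a single-player problem
driven by the opponent's own coins. -/
theorem histories_copyStrategy_right (D : DrawModel) (p : ℝ) (S : PureStrategy) (θ : I) (u : Coins)
    (t : ℕ) :
    (histories D p (S, copyStrategy, θ, u) t).1
      = withCopies (soloHistory p (againstCopy S) θ (playerCoins D Player.alice u) t) ∧
    (histories D p (S, copyStrategy, θ, u) t).2.map (fun o => o.2.1)
      = soloArms p (againstCopy S) θ (playerCoins D Player.alice u) t := by
  induction t with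
  | zero => exact ⟨rfl, rfl⟩
  | succ t ih =>
    obtain ⟨h1, h2⟩ := ih
    rw [soloArms_succ, soloHistory_succ]
    simp only [histories, withCopies, List.map_cons, h1, h2, copyStrategy]
    exact ⟨rfl, rfl⟩

theorem histories_copyStrategy_left (D : DrawModel) (p : ℝ) (S : PureStrategy) (θ : I) (u : Coins)
    (t : ℕ) :
    (histories D p (copyStrategy, S, θ, u) t).2
      = withCopies (soloHistory p (againstCopy S) θ (playerCoins D Player.bob u) t) ∧
    (histories D p (copyStrategy, S, θ, u) t).1.map (fun o => o.2.1)
      = soloArms p (againstCopy S) θ (playerCoins D Player.bob u) t := by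
  induction t with
  | zero => exact ⟨rfl, rfl⟩
  | succ t ih =>
    obtain ⟨h1, h2⟩ := ih
    rw [soloArms_succ, soloHistory_succ]
    simp only [histories, withCopies, List.map_cons, h1, h2, copyStrategy]
    exact ⟨rfl, rfl⟩

theorem expectedTotal_sub_of_solo (hβ0 : 0 < β) (hβ1 : β < 1) (p : ℝ) (S : SoloStrategy) (θ : I)
    (v : SoloCoins) :
    discount β (fun t => successProb p θ (soloArm p S θ v t))
      - discount β (fun t => successProb p θ (copyArm (soloArms p S θ v t)))
      = advantage β p S θ v := by
  rw [discount_successProb hβ0 hβ1, discount_successProb hβ0 hβ1, advantage, rightPulls]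
  ring

theorem expectedTotal_sub_copy_right (hβ0 : 0 < β) (hβ1 : β < 1) (D : DrawModel) (p : ℝ)
    (S : PureStrategy) (θ : I) (u : Coins) :
    expectedTotal D β p (S, copyStrategy, θ, u) Player.alice
      - expectedTotal D β p (S, copyStrategy, θ, u) Player.bob
      = advantage β p (againstCopy S) θ (playerCoins D Player.alice u) := by
  have hA : ∀ t, armPulled D p (S, copyStrategy, θ, u) t Player.alice
      = soloArm p (againstCopy S) θ (playerCoins D Player.alice u) t :=
    fun t => congrArg S (histories_copyStrategy_right D p S θ u t).1
  have hB : ∀ t, armPulled D p (S, copyStrategy, θ, u) t Player.bob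
      = copyArm (soloArms p (againstCopy S) θ (playerCoins D Player.alice u) t) :=
    fun t => congrArg copyArm (histories_copyStrategy_right D p S θ u t).2
  rw [← expectedTotal_sub_of_solo hβ0 hβ1]
  simp only [expectedTotal, hA, hB]

theorem expectedTotal_sub_copy_left (hβ0 : 0 < β) (hβ1 : β < 1) (D : DrawModel) (p : ℝ)
    (S : PureStrategy) (θ : I) (u : Coins) :
    expectedTotal D β p (copyStrategy, S, θ, u) Player.alice
      - expectedTotal D β p (copyStrategy, S, θ, u) Player.bob
      = -advantage β p (againstCopy S) θ (playerCoins D Player.bob u) := by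
  have hB : ∀ t, armPulled D p (copyStrategy, S, θ, u) t Player.bob
      = soloArm p (againstCopy S) θ (playerCoins D Player.bob u) t :=
    fun t => congrArg S (histories_copyStrategy_left D p S θ u t).1
  have hA : ∀ t, armPulled D p (copyStrategy, S, θ, u) t Player.alice
      = copyArm (soloArms p (againstCopy S) θ (playerCoins D Player.bob u) t) :=
    fun t => congrArg copyArm (histories_copyStrategy_left D p S θ u t).2
  rw [← expectedTotal_sub_of_solo hβ0 hβ1, neg_sub]
  simp only [expectedTotal, hA, hB]

theorem measurable_againstCopy : Measurable againstCopy :=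
  measurable_pi_lambda _ fun h => measurable_pi_apply (withCopies h)

/-- The expected discount factor of the first pull of the right arm, against the copying
strategy. -/
def exploration (μ : Measure I) (β p : ℝ) (τ : MixedStrategy) : ℝ :=
  ∫ x, firstPull β p (againstCopy x.1) x.2.1 x.2.2
    ∂((τ : Measure PureStrategy).prod (μ.prod soloCoinLaw))

theorem integrable_firstPull_againstCopy (hβ0 : 0 < β) (hβ1 : β < 1) (p : ℝ) (τ : MixedStrategy) :
    Integrable (fun x : PureStrategy × I × SoloCoins =>
      firstPull β p (againstCopy x.1) x.2.1 x.2.2)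
      ((τ : Measure PureStrategy).prod (μ.prod soloCoinLaw)) :=
  integrable_of_abs_le ((measurable_firstPull hβ0 hβ1 p).comp
    (f := fun x : PureStrategy × I × SoloCoins => (againstCopy x.1, x.2))
    ((measurable_againstCopy.comp measurable_fst).prodMk measurable_snd))
    fun _ => abs_firstPull_le hβ0 hβ1 _ _ _ _

theorem integrable_advantage_againstCopy (hβ0 : 0 < β) (hβ1 : β < 1) {p : ℝ}
    (hp : p ∈ Icc (0 : ℝ) 1) (τ : MixedStrategy) :
    Integrable (fun x : PureStrategy × I × SoloCoins =>
      advantage β p (againstCopy x.1) x.2.1 x.2.2)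
      ((τ : Measure PureStrategy).prod (μ.prod soloCoinLaw)) :=
  integrable_advantage hβ0 hβ1 hp
    (x := fun x : PureStrategy × I × SoloCoins => (againstCopy x.1, x.2))
    ((measurable_againstCopy.comp measurable_fst).prodMk measurable_snd)

theorem integral_advantage_againstCopy_le (hβ0 : 0 < β) (hβ1 : β < 1) {p q : ℝ}
    (hp : p ∈ Icc (0 : ℝ) 1) (hq : q ∈ Icc (0 : ℝ) 1) (h : AlwaysLeftOptimal μ β q)
    (τ : MixedStrategy) :
    ∫ x, advantage β p (againstCopy x.1) x.2.1 x.2.2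
        ∂((τ : Measure PureStrategy).prod (μ.prod soloCoinLaw))
      ≤ (max (q - p) 0 - β * (p - priorMean μ)) * exploration μ β p τ := by
  have i1 := integrable_advantage_againstCopy (μ := μ) hβ0 hβ1 hp τ
  have i2 := integrable_firstPull_againstCopy (μ := μ) hβ0 hβ1 p τ
  rw [exploration, integral_prod _ i1, integral_prod _ i2, ← integral_const_mul]
  exact integral_mono i1.integral_prod_left (i2.integral_prod_left.const_mul _)
    fun S => integral_advantage_le hβ0 hβ1 hp hq h (againstCopy S)

theorem utilityA_copy_right (hβ0 : 0 < β) (hβ1 : β < 1) (D : DrawModel) {p : ℝ}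
    (hp : p ∈ Icc (0 : ℝ) 1) (τ : MixedStrategy) :
    utilityA D μ β (-1) p τ (diracProba copyStrategy)
      = ∫ x, advantage β p (againstCopy x.1) x.2.1 x.2.2
        ∂((τ : Measure PureStrategy).prod (μ.prod soloCoinLaw)) := by
  have hv := measurePreserving_viewA (μ := μ) D τ (diracProba copyStrategy)
  have hi := integrable_advantage_againstCopy (μ := μ) hβ0 hβ1 hp τ
  rw [utilityA_neg_one hβ0 hβ1 D hp, ← hv.map_eq,
    integral_map hv.measurable.aemeasurable (by rw [hv.map_eq]; exact hi.aestronglyMeasurable)]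
  refine integral_congr_ae ?_
  filter_upwards [ae_snd_eq_of_dirac (μ := μ) τ copyStrategy] with ω hω
  obtain ⟨S, T, θ, u⟩ := ω
  obtain rfl : T = copyStrategy := hω
  exact expectedTotal_sub_copy_right hβ0 hβ1 D p S θ u

theorem utilityA_copy_left (hβ0 : 0 < β) (hβ1 : β < 1) (D : DrawModel) {p : ℝ}
    (hp : p ∈ Icc (0 : ℝ) 1) (τ : MixedStrategy) :
    utilityA D μ β (-1) p (diracProba copyStrategy) τ
      = -∫ x, advantage β p (againstCopy x.1) x.2.1 x.2.2
        ∂((τ : Measure PureStrategy).prod (μ.prod soloCoinLaw)) := by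
  have hv := measurePreserving_viewB (μ := μ) D (diracProba copyStrategy) τ
  have hi := integrable_advantage_againstCopy (μ := μ) hβ0 hβ1 hp τ
  rw [utilityA_neg_one hβ0 hβ1 D hp, ← hv.map_eq,
    integral_map hv.measurable.aemeasurable (by rw [hv.map_eq]; exact hi.aestronglyMeasurable),
    ← integral_neg]
  refine integral_congr_ae ?_
  filter_upwards [ae_fst_eq_of_dirac (μ := μ) τ copyStrategy] with ω hω
  obtain ⟨T, S, θ, u⟩ := ω
  obtain rfl : T = copyStrategy := hω
  exact expectedTotal_sub_copy_left hβ0 hβ1 D p S θ u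

/-! ### No exploration in equilibrium -/

theorem exploration_nonneg {μ : Measure I} (hβ0 : 0 < β) (p : ℝ) (τ : MixedStrategy) :
    0 ≤ exploration μ β p τ :=
  integral_nonneg fun _ => firstPull_nonneg hβ0 _ _ _ _

theorem right_not_mem_of_firstPull_eq_zero (hβ0 : 0 < β) (hβ1 : β < 1) {p : ℝ} {S : SoloStrategy}
    {θ : I} {v : SoloCoins} (h : firstPull β p S θ v = 0) (t : ℕ) :
    Arm.R ∉ soloArms p S θ v t := by
  induction t with
  | zero => exact List.not_mem_nil
  | succ t ih =>
    rw [soloArms_succ, List.mem_cons, not_or]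
    refine ⟨fun hR => ?_, ih⟩
    have := discount_eq_zero hβ0 hβ1 (fun t => abs_firstInd_le _ _)
      (fun t => firstInd_nonneg _ _) h t
    rw [firstInd, if_pos ⟨hR.symm, ih⟩] at this
    exact one_ne_zero this

/-- A non-negative function with integral zero vanishes almost everywhere, and a vanishing
`firstPull` leaves no round for a first pull of `R`. -/
theorem ae_right_not_mem (hβ0 : 0 < β) (hβ1 : β < 1) {p : ℝ} {τ : MixedStrategy}
    (h : exploration μ β p τ = 0) :
    ∀ᵐ x ∂((τ : Measure PureStrategy).prod (μ.prod soloCoinLaw)),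
      ∀ t, Arm.R ∉ soloArms p (againstCopy x.1) x.2.1 x.2.2 t := by
  filter_upwards [(integral_eq_zero_iff_of_nonneg (fun _ => firstPull_nonneg hβ0 _ _ _ _)
    (integrable_firstPull_againstCopy hβ0 hβ1 p τ)).1 h] with x hx t
  exact right_not_mem_of_firstPull_eq_zero hβ0 hβ1 hx t

theorem copyArm_eq_left {l : List Arm} (h : Arm.R ∉ l) : copyArm l = Arm.L := by
  cases l with
  | nil => rfl
  | cons a l =>
    rw [List.mem_cons, not_or] at h
    exact if_neg fun h' => h.2 h'.2

theorem soloArm_eq_left {p : ℝ} {S : SoloStrategy} {θ : I} {v : SoloCoins}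
    (h : ∀ t, Arm.R ∉ soloArms p S θ v t) (t : ℕ) : soloArm p S θ v t = Arm.L := by
  have := h (t + 1)
  rw [soloArms_succ, List.mem_cons, not_or] at this
  cases h3 : soloArm p S θ v t
  · rfl
  · exact absurd h3.symm this.1

/-- If neither player pulls the right arm against the copying strategy, then neither player does
against the other. -/
theorem histories_eq_of_not_mem (D : DrawModel) (p : ℝ) {SA SB : PureStrategy} {θ : I} {u : Coins}
    (hA : ∀ t, Arm.R ∉ soloArms p (againstCopy SA) θ (playerCoins D Player.alice u) t)
    (hB : ∀ t, Arm.R ∉ soloArms p (againstCopy SB) θ (playerCoins D Player.bob u) t) (t : ℕ) :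
    histories D p (SA, SB, θ, u) t
      = (withCopies (soloHistory p (againstCopy SA) θ (playerCoins D Player.alice u) t),
        withCopies (soloHistory p (againstCopy SB) θ (playerCoins D Player.bob u) t)) := by
  induction t with
  | zero => rfl
  | succ t ih =>
    have a1 : SA (withCopies (soloHistory p (againstCopy SA) θ (playerCoins D Player.alice u) t))
      = Arm.L := soloArm_eq_left hA t
    have b1 : SB (withCopies (soloHistory p (againstCopy SB) θ (playerCoins D Player.bob u) t))
      = Arm.L := soloArm_eq_left hB t
    have a2 : copyArm ((soloHistory p (againstCopy SA) θ (playerCoins D Player.alice u) t).map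
      Prod.fst) = Arm.L := copyArm_eq_left (hA t)
    have b2 : copyArm ((soloHistory p (againstCopy SB) θ (playerCoins D Player.bob u) t).map
      Prod.fst) = Arm.L := copyArm_eq_left (hB t)
    simp only [histories, ih, a1, b1, soloHistory_succ, withCopies, a2, b2, soloArm_eq_left hA,
      soloArm_eq_left hB]
    rfl

theorem not_explored_of_not_mem (D : DrawModel) (p : ℝ) {SA SB : PureStrategy} {θ : I} {u : Coins}
    (hA : ∀ t, Arm.R ∉ soloArms p (againstCopy SA) θ (playerCoins D Player.alice u) t)
    (hB : ∀ t, Arm.R ∉ soloArms p (againstCopy SB) θ (playerCoins D Player.bob u) t) :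
    ¬ Explored D p (SA, SB, θ, u) := by
  rintro ⟨t, i, h⟩
  have h0 := histories_eq_of_not_mem D p hA hB t
  cases i
  · rw [armPulled, h0] at h
    have := (soloArm_eq_left hA t).symm.trans h
    cases this
  · rw [armPulled, h0] at h
    have := (soloArm_eq_left hB t).symm.trans h
    cases this

/-- Above the bound, no Nash equilibrium explores the right arm. -/
theorem ae_not_explored_of_isNash (hβ0 : 0 < β) (hβ1 : β < 1) (D : DrawModel) {p : ℝ}
    (hp : p ∈ Icc (0 : ℝ) 1) (hm : priorMean μ < gittinsIndex μ β)
    (hlt : (priorMean μ * β + gittinsIndex μ β) / (1 + β) < p) {σA σB : MixedStrategy}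
    (hN : IsNash D μ β (-1) p σA σB) : ∀ᵐ ω ∂gameLaw μ σA σB, ¬ Explored D p ω := by
  rw [div_lt_iff₀ (by linarith)] at hlt
  have hpm : priorMean μ < p := by nlinarith
  -- The hypothesis on p, cleared of its denominator, says exactly g < p + β(p - m); a q below the
  -- right side makes the factor in `integral_advantage_le` negative.
  obtain ⟨q, hq, hqlt, hopt⟩ := exists_alwaysLeftOptimal_lt (μ := μ) hβ0 hβ1
    (x := p + β * (p - priorMean μ)) (by linarith)
  have hκ : max (q - p) 0 - β * (p - priorMean μ) < 0 := by
    have := mul_pos hβ0 (sub_pos.2 hpm)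
    rcases max_cases (q - p) 0 with h | h <;> linarith
  -- Let U be Alice's utility. Copying by Alice gives U ≥ -(lead of `σB`) ≥ 0, and copying by Bob
  -- gives U ≤ (lead of `σA`) ≤ 0. Both leads are therefore 0, and as the factor is strictly
  -- negative both explorations vanish.
  have h1 := hN.1 (diracProba copyStrategy)
  have h2 := hN.2 (diracProba copyStrategy)
  rw [utilityB_neg_one, utilityB_neg_one, utilityA_copy_right hβ0 hβ1 D hp] at h2
  rw [utilityA_copy_left hβ0 hβ1 D hp] at h1
  have hA := integral_advantage_againstCopy_le (μ := μ) hβ0 hβ1 hp hq hopt σA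
  have hB := integral_advantage_againstCopy_le (μ := μ) hβ0 hβ1 hp hq hopt σB
  have nA := exploration_nonneg (μ := μ) hβ0 p σA
  have nB := exploration_nonneg (μ := μ) hβ0 p σB
  have zA : exploration μ β p σA = 0 := by nlinarith
  have zB : exploration μ β p σB = 0 := by nlinarith
  have aA := (measurePreserving_viewA (μ := μ) D σA σB).quasiMeasurePreserving.ae
    (ae_right_not_mem hβ0 hβ1 zA)
  have aB := (measurePreserving_viewB (μ := μ) D σA σB).quasiMeasurePreserving.ae
    (ae_right_not_mem hβ0 hβ1 zB)
  filter_upwards [aA, aB] with ω h3 h4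
  exact not_explored_of_not_mem D p h3 h4

/-! ### An exploring equilibrium -/

/-- The strategy of pulling the right arm in every round. -/
def alwaysRight : PureStrategy := fun _ => Arm.R

/-- At p = 0 only pulls of `R` pay, so pulling `R` in every round is at least as good as anything
else for every θ. -/
theorem expectedTotal_zero (hβ0 : 0 < β) (hβ1 : β < 1) (D : DrawModel) (ω : Sample) (i : Player) :
    expectedTotal D β 0 ω i = ω.2.2.1 * discount β fun t => rightInd (armPulled D 0 ω t i) := by
  rw [expectedTotal, discount_successProb hβ0 hβ1]
  ring

theorem expectedTotal_zero_le (hβ0 : 0 < β) (hβ1 : β < 1) (D : DrawModel) (ω : Sample)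
    {i j : Player} (h : ∀ t, armPulled D 0 ω t j = Arm.R) :
    expectedTotal D β 0 ω i ≤ expectedTotal D β 0 ω j := by
  rw [expectedTotal_zero hβ0 hβ1, expectedTotal_zero hβ0 hβ1]
  refine mul_le_mul_of_nonneg_left (discount_mono hβ0 hβ1 (fun t => abs_rightInd_le _)
    (fun t => abs_rightInd_le _) fun t => ?_) ω.2.2.1.2.1
  rw [h t, rightInd, rightInd]
  split_ifs <;> simp_all

theorem utilityA_alwaysRight_right (hβ0 : 0 < β) (hβ1 : β < 1) (D : DrawModel)
    (τ : MixedStrategy) : utilityA D μ β (-1) 0 τ (diracProba alwaysRight) ≤ 0 := by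
  rw [utilityA_neg_one hβ0 hβ1 D (by simp)]
  refine integral_nonpos_of_ae ?_
  filter_upwards [ae_snd_eq_of_dirac (μ := μ) τ alwaysRight] with ω hω
  refine sub_nonpos.2 (expectedTotal_zero_le hβ0 hβ1 D ω fun t => ?_)
  rw [armPulled, hω, alwaysRight]

theorem utilityA_alwaysRight_left (hβ0 : 0 < β) (hβ1 : β < 1) (D : DrawModel)
    (τ : MixedStrategy) : 0 ≤ utilityA D μ β (-1) 0 (diracProba alwaysRight) τ := by
  rw [utilityA_neg_one hβ0 hβ1 D (by simp)]
  refine integral_nonneg_of_ae ?_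
  filter_upwards [ae_fst_eq_of_dirac (μ := μ) τ alwaysRight] with ω hω
  refine sub_nonneg.2 (expectedTotal_zero_le hβ0 hβ1 D ω fun t => ?_)
  rw [armPulled, hω, alwaysRight]

/-- Always pulling `R` secures each player a utility of at least 0, so the pair is a saddle point of
value 0. -/
theorem zero_mem_exploringSet (hβ0 : 0 < β) (hβ1 : β < 1) (D : DrawModel) :
    (0 : ℝ) ∈ exploringSet D μ β (-1) := by
  refine ⟨by simp, diracProba alwaysRight, diracProba alwaysRight, ⟨fun τ => ?_, fun τ => ?_⟩, ?_⟩
  · exact (utilityA_alwaysRight_right hβ0 hβ1 D τ).trans (utilityA_alwaysRight_left hβ0 hβ1 D _)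
  · rw [utilityB_neg_one, utilityB_neg_one, neg_le_neg_iff]
    exact (utilityA_alwaysRight_right hβ0 hβ1 D _).trans (utilityA_alwaysRight_left hβ0 hβ1 D τ)
  · refine pos_iff_ne_zero.2 fun h => ?_
    have h1 : ∀ᵐ ω ∂gameLaw μ (diracProba alwaysRight) (diracProba alwaysRight),
        ¬ Explored D 0 ω := by
      rw [ae_iff]; simpa using h
    obtain ⟨ω, h2, h3⟩ := (h1.and (ae_fst_eq_of_dirac (μ := μ) _ alwaysRight)).exists
    exact h2 ⟨0, Player.alice, by rw [armPulled, h3, alwaysRight]⟩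

end Bandit

end

/-! ### The main theorem -/

theorem theorem1 (D : Bandit.DrawModel)
    (μ : Measure unitInterval) [IsProbabilityMeasure μ]
    (hμ : ∀ x : unitInterval, μ ≠ Measure.dirac x)
    (β : ℝ) (hβ0 : 0 < β) (hβ1 : β < 1) :
    -- `p*` is a genuine supremum, not a default value
    IsLUB (Bandit.exploringSet D μ β (-1)) (Bandit.pStar D μ β (-1)) ∧
    Bandit.pStar D μ β (-1) ≤
      (Bandit.priorMean μ * β + Bandit.gittinsIndex μ β) / (1 + β) ∧
    (Bandit.priorMean μ * β + Bandit.gittinsIndex μ β) / (1 + β) < Bandit.gittinsIndex μ β ∧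
    Bandit.pStar D μ β (-1) < Bandit.gittinsIndex μ β ∧
    (∀ p ∈ Set.Icc (0 : ℝ) 1, Bandit.pStar D μ β (-1) < p →
      ∀ σA σB : Bandit.MixedStrategy, Bandit.IsNash D μ β (-1) p σA σB →
        ∀ᵐ ω ∂(Bandit.gameLaw μ σA σB), ¬ Bandit.Explored D p ω) := by
  have hm := Bandit.priorMean_lt_gittinsIndex hμ hβ0 hβ1
  have hlub : IsLUB (Bandit.exploringSet D μ β (-1)) (Bandit.pStar D μ β (-1)) :=
    isLUB_csSup ⟨0, Bandit.zero_mem_exploringSet hβ0 hβ1 D⟩ ⟨1, fun p hp => hp.1.2⟩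
  have hle : Bandit.pStar D μ β (-1) ≤
      (Bandit.priorMean μ * β + Bandit.gittinsIndex μ β) / (1 + β) := by
    refine hlub.2 fun p hp => ?_
    obtain ⟨hpI, σA, σB, hN, hpos⟩ := hp
    by_contra! hlt
    have := Bandit.ae_not_explored_of_isNash hβ0 hβ1 D hpI hm hlt hN
    rw [ae_iff] at this
    simp only [not_not] at this
    exact hpos.ne' this
  have hlt : (Bandit.priorMean μ * β + Bandit.gittinsIndex μ β) / (1 + β)
      < Bandit.gittinsIndex μ β := by
    rw [div_lt_iff₀ (by linarith)]
    nlinarith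
  refine ⟨hlub, hle, hlt, hle.trans_lt hlt, fun p hp hpp σA σB hN => ?_⟩
  rw [ae_iff]
  simp only [not_not]
  by_contra h
  -- Exploration with positive probability would put p into the set whose supremum is p*, against p
  -- > p*.
  exact absurd (hlub.1 ⟨hp, σA, σB, hN, pos_iff_ne_zero.2 h⟩) (not_le.2 hpp)
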